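/- Let $\mathfrak g$ be a finite-dimensional complex simple Lie algebra with Cartan subalgebra $\mathfrak h$ and a choice of simple roots, $W$ its Weyl group with sign character $\sigma\mapsto(-1)^\sigma=\det\sigma$, $\rho$ half the sum of the positive roots, $\Lambda$ the weight lattice and $\Lambda^+\subset\Lambda$ the set of dominant weights. Let $a\ge 1$ be an integer, $\lambda\in\Lambda^+$, and let $V_\lambda$ be the irreducible finite-dimensional representation with highest weight $\lambda$, $\Pi_\lambda$ its set of weights, $m_\lambda^\nu$ the dimension of its $\nu$-weight space, and $\mathrm{ch}_\lambda=\sum_\nu m_\lambda^\nu e_\nu\in\mathbb Z[\Lambda]$ its formal character. Let $\psi_a$ be the $a$-th Adams operation, i.e. the ring endomorphism $e_\nu\mapsto e_{a\nu}$. Then there are unique integers $m^\mu_{\lambda,a}$ ($\mu\in\Lambda^+$), almost all zero, with $$\psi_a(\mathrm{ch}_\lambda)=\sum_{\mu\in\Lambda^+}m^\mu_{\lambda,a}\,\mathrm{ch}_\mu ,$$ and the following hold. (a) For every $\mu\in\Lambda^+$, $$m^{\mu}_{\lambda,a}=\sum_{\sigma}(-1)^\sigma\, m_{\lambda}^{(\mu+\rho-\sigma(\rho))/a},$$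 where the sum is over the $\sigma\in W$ such that $(\mu+\rho-\sigma(\rho))/a\in\Lambda$. (b) Let $S_{\lambda,a}$ be the set of $\mu\in\Lambda^+$ for which at least one term of the sum in (a) is nonzero. Then $$S_{\lambda,a}=\Big[\bigcup_{\sigma\in W}\big(\sigma(\rho)-\rho+a\,\Pi_\lambda\big)\Big]\cap\Lambda^+ ,$$ this set is finite, it contains every $\mu$ with $m^\mu_{\lambda,a}\neq 0$, and hence $\psi_a(\mathrm{ch}_\lambda)=\sum_{\mu\in S_{\lambda,a}}m^\mu_{\lambda,a}\,\mathrm{ch}_\mu$. -/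

import Mathlib

open Module LieAlgebra.IsKilling

noncomputable section

namespace Plethysm

/-- A finite root system has finitely many automorphisms. -/
theorem finite_aut {ι R M N : Type*} [Finite ι] [CommRing R] [AddCommGroup M] [Module R M]
    [AddCommGroup N] [Module R N] (P : RootPairing ι R M N) [P.IsRootSystem] :
    Finite P.Aut := by
  refine Finite.of_injective (fun g : P.Aut => g.indexEquiv) ?_
  intro g h hgh
  have h1 : g.indexEquiv = h.indexEquiv := hgh
  have h2 : g.weightMap = h.weightMap := by
    refine LinearMap.ext_on_range (v := P.root) RootPairing.IsRootSystem.span_root_eq_top ?_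
    intro i
    have e1 := RootPairing.Hom.root_weightMap_apply (P := P) (Q := P) i g.toHom
    have e2 := RootPairing.Hom.root_weightMap_apply (P := P) (Q := P) i h.toHom
    rw [e1, e2, h1]
  have h3 : g.coweightMap = h.coweightMap := by
    refine LinearMap.ext_on_range (v := P.coroot) RootPairing.IsRootSystem.span_coroot_eq_top ?_
    intro i
    have e1 := RootPairing.Hom.coroot_coweightMap_apply (P := P) (Q := P) i g.toHom
    have e2 := RootPairing.Hom.coroot_coweightMap_apply (P := P) (Q := P) i h.toHom
    rw [e1, e2, h1]
  exact RootPairing.Equiv.ext h2 h3 h1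

variable {L : Type*} [LieRing L] [LieAlgebra ℂ L] [FiniteDimensional ℂ L]
  [LieAlgebra.IsSimple ℂ L] {H : LieSubalgebra ℂ L} [H.IsCartanSubalgebra]

variable (H) in
/-- The Weyl group `W` of the root system of `(L, H)`; it acts on the dual of `H` by `σ • μ`. -/
abbrev Weyl : Type _ := (rootSystem H).weylGroup

instance : Finite (Weyl H) :=
  haveI := finite_aut (rootSystem H)
  inferInstanceAs (Finite (rootSystem H).weylGroup)

instance : Fintype (Weyl H) := Fintype.ofFinite _

/-- The sign `(-1)^σ = det σ` of a Weyl group element. -/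
def weylSign (σ : Weyl H) : ℂ :=
  LinearMap.det ((rootSystem H).weylGroupRootRep σ)

variable (H) in
/-- The weight lattice `Λ`: functionals that are integral on all coroots. -/
def weightLattice : Set (Dual ℂ H) :=
  {μ | ∀ i, ∃ n : ℤ, μ ((rootSystem H).coroot i) = n}

/-- The set `Λ⁺` of dominant (integral) weights with respect to the base `b`: functionals taking
nonnegative integer values on all simple coroots. -/
def dominantWeights (b : (rootSystem H).Base) : Set (Dual ℂ H) :=
  {μ | ∀ i ∈ b.support, ∃ n : ℕ, μ ((rootSystem H).coroot i) = n}

open Classical in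
/-- Half the sum of the positive roots. -/
def rho (b : (rootSystem H).Base) : Dual ℂ H :=
  (2⁻¹ : ℂ) • ∑ i with b.IsPos i, (rootSystem H).root i

section Module

variable (V : Type*) [AddCommGroup V] [Module ℂ V] [LieRingModule L V] [LieModule ℂ L V]

/-- The multiplicity of the weight `ν` in `V`: the dimension of
`{v | ∀ h ∈ H, h v = ν(h) v}`. -/
def weightMult (ν : Dual ℂ H) : ℕ :=
  finrank ℂ (LieModule.weightSpace V (ν : H → ℂ))

variable (H) in
/-- The set `Π` of all weights of `V`. -/
def weightSet : Set (Dual ℂ H) :=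
  {ν | ∃ v : V, v ≠ 0 ∧ ∀ h : H, ⁅h, v⁆ = ν h • v}

/-- `V` is an irreducible finite-dimensional representation of `L` with highest weight `lam`
(with respect to the base `b`). -/
def IsIrreducibleOfHighestWeight (b : (rootSystem H).Base) (lam : Dual ℂ H) : Prop :=
  FiniteDimensional ℂ V ∧ LieModule.IsIrreducible ℂ L V ∧
    ∃ v : V, v ≠ 0 ∧ (∀ h : H, ⁅h, v⁆ = lam h • v) ∧
      ∀ i : H.root, b.IsPos i →
        ∀ x ∈ LieAlgebra.rootSpace H ((rootSystem H).root i : H → ℂ), ⁅x, v⁆ = 0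

theorem finite_support_weightMult [FiniteDimensional ℂ V] :
    (Function.support fun ν : Dual ℂ H => (weightMult V ν : ℤ)).Finite := by
  have h := LieModule.finite_genWeightSpace_ne_bot ℂ H V
  refine (h.preimage (f := fun ν : Dual ℂ H => (ν : H → ℂ))
    (fun _ _ _ _ e => DFunLike.coe_injective e)).subset ?_
  intro ν hν
  simp only [Set.mem_preimage, Set.mem_ofPred_eq]
  intro hbot
  apply hν
  have h0 : LieModule.weightSpace V (ν : H → ℂ) = ⊥ := by
    rw [eq_bot_iff, ← hbot]
    exact LieModule.weightSpace_le_genWeightSpace V _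
  change ((weightMult V ν : ℕ) : ℤ) = 0
  unfold weightMult
  rw [h0, Nat.cast_eq_zero]
  exact finrank_bot ℂ V

variable (H) in
/-- The formal character `∑_ν m_V^ν e_ν` of a finite-dimensional representation `V`, in the group
ring of the dual of `H` (the group ring of the weight lattice is a subring). -/
def formalCharacter [FiniteDimensional ℂ V] : AddMonoidAlgebra ℤ (Dual ℂ H) :=
  .ofCoeff (Finsupp.ofSupportFinite (fun ν => (weightMult V ν : ℤ)) (finite_support_weightMult V))

end Module

/-- `χ` is the character of an irreducible finite-dimensional representation of highest weight
`μ`. -/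
def IsIrreducibleCharacter (b : (rootSystem H).Base) (μ : Dual ℂ H)
    (χ : AddMonoidAlgebra ℤ (Dual ℂ H)) : Prop :=
  ∃ (V : Type) (_ : AddCommGroup V) (_ : Module ℂ V) (_ : LieRingModule L V)
    (_ : LieModule ℂ L V) (_ : FiniteDimensional ℂ V),
    IsIrreducibleOfHighestWeight V b μ ∧ χ = formalCharacter H V

/-- The `a`-th Adams operation: the ring endomorphism `e_μ ↦ e_{aμ}` of the group ring. -/
def adams (a : ℕ) : AddMonoidAlgebra ℤ (Dual ℂ H) →+* AddMonoidAlgebra ℤ (Dual ℂ H) :=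
  AddMonoidAlgebra.mapDomainRingHom ℤ (nsmulAddMonoidHom a : Dual ℂ H →+ Dual ℂ H)

/-- `m` is a system of multiplicities of the irreducible representations `V_μ`, `μ ∈ Λ⁺`, in the
virtual character `f`: `f = ∑_μ m(μ) ch(V_μ)`, a finite sum over dominant weights `μ`. -/
def IsMultiplicityFunction (b : (rootSystem H).Base) (f : AddMonoidAlgebra ℤ (Dual ℂ H))
    (m : Dual ℂ H →₀ ℤ) : Prop :=
  ∃ χ : Dual ℂ H → AddMonoidAlgebra ℤ (Dual ℂ H),
    (∀ μ ∈ m.support, μ ∈ dominantWeights b ∧ IsIrreducibleCharacter b μ (χ μ)) ∧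
    f = ∑ μ ∈ m.support, m μ • χ μ

/-- The weight `(μ + ρ - σ(ρ)) / a`. -/
def shiftedWeight (b : (rootSystem H).Base) (a : ℕ) (μ : Dual ℂ H) (σ : Weyl H) : Dual ℂ H :=
  (a : ℂ)⁻¹ • (μ + rho b - σ • rho b)

/-- The summation set: dominant weights `μ` for which the alternating sum
`∑_σ (-1)^σ m_V^{(μ + ρ - σ(ρ))/a}` has at least one nonzero term. -/
def summationSet (b : (rootSystem H).Base) (a : ℕ) (V : Type*) [AddCommGroup V] [Module ℂ V]
    [LieRingModule L V] [LieModule ℂ L V] : Set (Dual ℂ H) :=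
  {μ | μ ∈ dominantWeights b ∧ ∃ σ : Weyl H, shiftedWeight b a μ σ ∈ weightLattice H ∧
    weightMult V (shiftedWeight b a μ σ) ≠ 0}

end Plethysm

end

/-! Multiplicities are read off after multiplication by the Weyl denominator D = e_ρ ∏_{α>0} (1 -
e_{-α}). For dominant λ, μ the coefficient of e_{μ+ρ} in D·ch_λ is 1 if μ = λ and 0 otherwise
(`coeff_weylDenominator_mul_character`). Hence if f = ∑ m(μ) ch_μ, then m(μ) is the coefficient of
e_{μ+ρ} in D·f, which gives uniqueness. Since also D = ∑_σ det(σ) e_{σρ} (`weylDenominator_eq_sum`),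
that coefficient for f = ψ_a(ch_λ) is the alternating sum of (a). Part (b) follows because V_λ has
finitely many weights, all of them in Λ.

Denominator formula: D is antisymmetric under W, has leading term e_ρ, and its exponents lie below
ρ. If ν is an exponent of largest height in its orbit, then ν - ρ is dominant while ρ - ν is a sum
of simple roots, and positivity of the form forces ν = ρ. So all exponents lie in Wρ, on which W
acts freely by an exchange argument on words in simple reflections.

Character formula: the Casimir operator is a scalar c on an irreducible module. Traces over the
weight spaces turn this into an identity for ch, and this identity says that D·ch is an eigenvector,
with eigenvalue (ρ,ρ) + c, of the Laplacian e_ν ↦ (ν,ν) e_ν (`laplace_weylDenominator_mul`). All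
exponents of D·ch thus have the same norm, while (λ+μ+2ρ, λ-μ) > 0 for dominant μ ≠ λ below λ.

Existence of the multiplicities: characters of weight modules are integral combinations of
irreducible ones, by induction on dimension through submodules and quotients, and these combinations
are closed under products because of tensor products. If ch_V = ∑ e_{w_i}, then ψ_a(ch_V) is the
power sum p_a of the e_{w_i}, and Newton's identity n h_n = ∑_{k=1}^n p_k h_{n-k} with h_n =
ch(Sym^n V) and h_0 = 1 solves for p_a over ℤ. Neither complete reducibility nor the existence of a
module for each dominant weight is needed. -/

set_option linter.unusedSectionVars false

noncomputable section

namespace Plethysm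

variable {L : Type*} [LieRing L] [LieAlgebra ℂ L] [FiniteDimensional ℂ L]
  [LieAlgebra.IsSimple ℂ L] {H : LieSubalgebra ℂ L} [H.IsCartanSubalgebra]

/-! ### The form on the dual of `H`, and its positivity on the cone of simple roots -/

section

open scoped ComplexOrder

variable (H) in
/-- The bilinear form on the dual of `H` induced by the Killing form. -/
def dualForm : LinearMap.BilinForm ℂ (Dual ℂ H) :=
  LinearMap.id.compl₂ ((cartanEquivDual H).symm : Dual ℂ H →ₗ[ℂ] H)

theorem dualForm_apply (μ ν : Dual ℂ H) :
    dualForm H μ ν = μ ((cartanEquivDual H).symm ν) := rfl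

theorem dualForm_eq_traceForm (μ ν : Dual ℂ H) :
    dualForm H μ ν = LieModule.traceForm ℂ H L ((cartanEquivDual H).symm μ)
      ((cartanEquivDual H).symm ν) := by
  conv_lhs => rw [dualForm_apply, ← (cartanEquivDual H).apply_symm_apply μ]
  rfl

theorem dualForm_comm (μ ν : Dual ℂ H) : dualForm H μ ν = dualForm H ν μ := by
  rw [dualForm_eq_traceForm, dualForm_eq_traceForm, LieModule.traceForm_comm]

theorem traceForm_cartan_eq_sum (x y : H) :
    LieModule.traceForm ℂ H L x y = ∑ α : H.root, (rootSystem H).root α x *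
      (rootSystem H).root α y := by
  have h := LinearMap.congr_fun (LinearMap.congr_fun
    (restrict_killingForm_eq_sum (K := ℂ) (L := L) (H := H)) x) y
  rw [LieAlgebra.restrict_killingForm] at h
  rw [h, ← Finset.sum_coe_sort H.root]
  simp only [LinearMap.sum_apply]
  rfl

theorem root_apply_coroot_eq_intCast (i j : H.root) :
    (rootSystem H).root i ((rootSystem H).coroot j) = ((rootSystem H).pairingIn ℤ i j : ℤ) := by
  have := (rootSystem H).algebraMap_pairingIn ℤ i j
  simpa using this.symm

theorem root_apply_coroot_self (i : H.root) :
    (rootSystem H).root i ((rootSystem H).coroot i) = 2 := by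
  rw [root_apply_coroot_eq_intCast]
  simp

/-- The Killing form gives the coroot h of α the square norm ∑_β β(h)², a sum of squares of integers
containing 2², and also 4/(α,α). In `ComplexOrder`, 0 < z includes that z is real, so no separate
reality statement is needed. -/
theorem dualForm_root_self_pos (i : H.root) :
    0 < dualForm H ((rootSystem H).root i) ((rootSystem H).root i) := by
  have h1 := traceForm_coroot (i : LieModule.Weight ℂ H L) ((rootSystem H).coroot i)
  have h2 : (i : LieModule.Weight ℂ H L) ((rootSystem H).coroot i) = 2 :=
    root_apply_coroot_self i
  rw [h2] at h1
  have h3 : (i : LieModule.Weight ℂ H L) ((cartanEquivDual H).symm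
      (i : LieModule.Weight ℂ H L)) =
      dualForm H ((rootSystem H).root i) ((rootSystem H).root i) := rfl
  rw [h3] at h1
  have h4 := traceForm_cartan_eq_sum ((rootSystem H).coroot i) ((rootSystem H).coroot i)
  replace h4 := h1.symm.trans h4
  have h5 : (0 : ℂ) < ∑ α : H.root, (rootSystem H).root α ((rootSystem H).coroot i) *
      (rootSystem H).root α ((rootSystem H).coroot i) := by
    simp only [root_apply_coroot_eq_intCast]
    norm_cast
    refine Finset.sum_pos' (fun _ _ => mul_self_nonneg _) ⟨i, Finset.mem_univ _, ?_⟩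
    simp
  rw [← h4] at h5
  have h6 : dualForm H ((rootSystem H).root i) ((rootSystem H).root i) =
    4 * (2 • (dualForm H ((rootSystem H).root i) ((rootSystem H).root i))⁻¹ • (2 : ℂ))⁻¹ := by
    simp only [nsmul_eq_mul, smul_eq_mul, mul_inv, inv_inv]
    push_cast
    ring
  rw [h6]
  exact mul_pos (by norm_num) (by rw [RCLike.inv_pos]; exact h5)

theorem dualForm_root_right (μ : Dual ℂ H) (i : H.root) :
    dualForm H μ ((rootSystem H).root i) =
      dualForm H ((rootSystem H).root i) ((rootSystem H).root i) / 2 *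
        μ ((rootSystem H).coroot i) := by
  have h := (dualForm_root_self_pos i).ne'
  have h3 : (rootSystem H).coroot i = (2 : ℂ) •
    (dualForm H ((rootSystem H).root i) ((rootSystem H).root i))⁻¹ •
      (cartanEquivDual H).symm ((rootSystem H).root i) := by
    rw [two_smul, ← two_nsmul]; rfl
  rw [h3, map_smul, map_smul, dualForm_apply μ, smul_eq_mul, smul_eq_mul]
  field_simp

variable (b : (rootSystem H).Base)

/-- The monoid generated by the simple roots. -/
def posCone : AddSubmonoid (Dual ℂ H) := AddSubmonoid.closure ((rootSystem H).root '' b.support)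

theorem root_mem_posCone {i : H.root} (hi : b.IsPos i) : (rootSystem H).root i ∈ posCone b := by
  obtain ⟨f, -, h | h⟩ := b.exists_root_eq_sum_nat_or_neg i
  · rw [h]
    exact AddSubmonoid.sum_mem _ fun j hj => AddSubmonoid.nsmul_mem _
      (AddSubmonoid.subset_closure (Set.mem_image_of_mem _ hj)) _
  · exfalso
    -- Nonpositive coefficients would make the height nonpositive.
    have h' : (rootSystem H).root i = ∑ j ∈ b.support, (-(f j : ℤ)) • (rootSystem H).root j := by
      rw [h, ← Finset.sum_neg_distrib]
      exact Finset.sum_congr rfl fun j _ => by simp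
    have := RootPairing.Base.height_eq_sum (b := b) (f := fun j => -(f j : ℤ)) h'
    rw [RootPairing.Base.isPos_iff, this, Finset.sum_neg_distrib] at hi
    have : 0 ≤ ∑ j ∈ b.support, (f j : ℤ) := Finset.sum_nonneg fun _ _ => by positivity
    omega

/-- The linear functional on the dual of `H` with value `1` at each simple root. -/
def heightFun : Dual ℂ H →ₗ[ℂ] ℂ := b.toWeightBasis.constr ℂ fun _ => (1 : ℂ)

theorem heightFun_simple {i : H.root} (hi : i ∈ b.support) :
    heightFun b ((rootSystem H).root i) = 1 := by
  have := b.toWeightBasis.constr_basis ℂ (fun _ => (1 : ℂ)) ⟨i, hi⟩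
  rwa [RootPairing.Base.toWeightBasis_apply] at this

/-- Every generator has height 1, so only the empty sum has height 0. This is why the cone contains
no line, and why height can serve as a strictly monotone measure. -/
theorem heightFun_of_mem_posCone {β : Dual ℂ H} (hβ : β ∈ posCone b) :
    ∃ n : ℕ, heightFun b β = n ∧ (n = 0 → β = 0) := by
  induction hβ using AddSubmonoid.closure_induction with
  | mem x hx =>
    obtain ⟨i, hi, rfl⟩ := hx
    exact ⟨1, by simpa using heightFun_simple b hi, by simp⟩
  | zero => exact ⟨0, by simp, by simp⟩
  | add x y _ _ hx hy =>
    obtain ⟨n, hn, hn'⟩ := hx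
    obtain ⟨m, hm, hm'⟩ := hy
    refine ⟨n + m, by simp [hn, hm], fun h => ?_⟩
    rw [hn' (by omega), hm' (by omega), add_zero]

theorem heightFun_pos {β : Dual ℂ H} (hβ : β ∈ posCone b) (h : β ≠ 0) :
    0 < (heightFun b β).re := by
  obtain ⟨n, hn, hn'⟩ := heightFun_of_mem_posCone b hβ
  rw [hn, Complex.natCast_re, Nat.cast_pos]
  exact Nat.pos_of_ne_zero fun h0 => h (hn' h0)

theorem heightFun_nonneg {β : Dual ℂ H} (hβ : β ∈ posCone b) : 0 ≤ (heightFun b β).re := by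
  obtain ⟨n, hn, -⟩ := heightFun_of_mem_posCone b hβ
  simp [hn]

theorem eq_zero_of_mem_posCone_of_neg_mem {β : Dual ℂ H} (hβ : β ∈ posCone b)
    (hβ' : -β ∈ posCone b) : β = 0 := by
  by_contra h
  have h1 := heightFun_pos b hβ h
  have h2 := heightFun_nonneg b hβ'
  simp only [map_neg, Complex.neg_re] at h2
  linarith

variable {b}

theorem dualForm_nonneg_of_mem_posCone {β ν : Dual ℂ H} (hβ : β ∈ posCone b)
    (hν : ∀ i ∈ b.support, 0 ≤ ν ((rootSystem H).coroot i)) : 0 ≤ dualForm H ν β := by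
  induction hβ using AddSubmonoid.closure_induction with
  | mem x hx =>
    obtain ⟨i, hi, rfl⟩ := hx
    rw [dualForm_root_right]
    exact mul_nonneg (div_nonneg (dualForm_root_self_pos i).le (by norm_num)) (hν i hi)
  | zero => simp
  | add x y _ _ hx hy => simpa using add_nonneg hx hy

theorem dualForm_pos_of_mem_posCone {β ν : Dual ℂ H} (hβ : β ∈ posCone b) (h0 : β ≠ 0)
    (hν : ∀ i ∈ b.support, 0 < ν ((rootSystem H).coroot i)) : 0 < dualForm H ν β := by
  have key : β = 0 ∨ 0 < dualForm H ν β := by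
    clear h0
    induction hβ using AddSubmonoid.closure_induction with
    | mem x hx =>
      right
      obtain ⟨i, hi, rfl⟩ := hx
      rw [dualForm_root_right]
      exact mul_pos (div_pos (dualForm_root_self_pos i) (by norm_num)) (hν i hi)
    | zero => simp
    | add x y _ _ hx hy =>
      rcases hx with rfl | hx
      · simpa using hy
      · rcases hy with rfl | hy
        · right; simpa using hx
        · right; simpa using add_pos hx hy
  exact key.resolve_left h0

theorem exists_real_root_apply_of_mem_posCone {β : Dual ℂ H} (hβ : β ∈ posCone b) (j : H.root) :
    ∃ r : ℝ, (rootSystem H).root j ((cartanEquivDual H).symm β) = r := by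
  induction hβ using AddSubmonoid.closure_induction with
  | mem x hx =>
    obtain ⟨i, hi, rfl⟩ := hx
    rw [← dualForm_apply, dualForm_root_right, root_apply_coroot_eq_intCast]
    have := (Complex.le_def.mp (dualForm_root_self_pos i).le).2
    generalize dualForm H ((rootSystem H).root i) ((rootSystem H).root i) = z at this ⊢
    refine ⟨z.re / 2 * ((rootSystem H).pairingIn ℤ j i : ℤ), ?_⟩
    apply Complex.ext
    · simp
    · simp [← this]
  | zero => exact ⟨0, by simp⟩
  | add x y _ _ hx hy =>
    obtain ⟨r, hr⟩ := hx
    obtain ⟨s, hs⟩ := hy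
    exact ⟨r + s, by simp only [map_add]; rw [hr, hs]; simp⟩

/-- The complex bilinear form is definite only on the real span of the roots. On the cone all roots
take real values, so (β,β) is a sum of real squares; if it is not positive, every root kills β, and
the roots span the dual. -/
theorem eq_zero_of_dualForm_self_nonpos {β : Dual ℂ H} (hβ : β ∈ posCone b)
    (h : dualForm H β β ≤ 0) : β = 0 := by
  choose r hr using exists_real_root_apply_of_mem_posCone hβ
  rw [dualForm_eq_traceForm, traceForm_cartan_eq_sum] at h
  simp only [hr] at h
  norm_cast at h
  have h0 : ∑ i, r i * r i = 0 := le_antisymm h (Finset.sum_nonneg fun _ _ => mul_self_nonneg _)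
  rw [Finset.sum_eq_zero_iff_of_nonneg fun _ _ => mul_self_nonneg _] at h0
  have h1 : ∀ j, (rootSystem H).root j ((cartanEquivDual H).symm β) = 0 := fun j => by
    rw [hr, mul_self_eq_zero.mp (h0 j (Finset.mem_univ _)), Complex.ofReal_zero]
  have h2 : ∀ f : Dual ℂ H, f ((cartanEquivDual H).symm β) = 0 := fun f => by
    have hf : f ∈ Submodule.span ℂ (Set.range (rootSystem H).root) := by
      rw [RootPairing.IsRootSystem.span_root_eq_top]; trivial
    induction hf using Submodule.span_induction with
    | mem x hx => obtain ⟨j, rfl⟩ := hx; exact h1 j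
    | zero => simp
    | add x y _ _ hx hy => simp [hx, hy]
    | smul c x _ hx => simp [hx]
  have h3 := (Module.forall_dual_apply_eq_zero_iff ℂ _).mp h2
  simpa using h3

end

/-! ### The Weyl group: simple reflections, the vector ρ, exchange argument, sign -/

section

variable {b : (rootSystem H).Base}

open scoped ComplexOrder

/-- The reflection in the Weyl group attached to a root. -/
abbrev refl (i : H.root) : Weyl H := RootPairing.weylGroup.ofIdx (rootSystem H) i

theorem refl_smul (i : H.root) (μ : Dual ℂ H) :
    refl i • μ = μ - μ ((rootSystem H).coroot i) • (rootSystem H).root i := by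
  rw [RootPairing.weylGroup.ofIdx_smul, RootPairing.Equiv.reflection_smul,
    RootPairing.reflection_apply]
  rfl

theorem refl_smul_root_self (i : H.root) :
    refl i • (rootSystem H).root i = -(rootSystem H).root i := by
  rw [refl_smul, root_apply_coroot_self, two_smul]
  abel

theorem refl_smul_root (i j : H.root) :
    refl i • (rootSystem H).root j = (rootSystem H).root ((rootSystem H).reflectionPerm i j) := by
  rw [RootPairing.root_reflectionPerm]
  rfl

theorem weyl_ext {σ τ : Weyl H} (h : ∀ μ : Dual ℂ H, σ • μ = τ • μ) : σ = τ := by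
  apply Subtype.ext
  apply RootPairing.Equiv.weightHom_injective (rootSystem H)
  ext1 μ
  exact h μ

theorem weyl_smul_smul (σ : Weyl H) (c : ℂ) (μ : Dual ℂ H) : σ • (c • μ) = c • σ • μ :=
  map_smul ((rootSystem H).weylGroupRootRep σ) c μ

theorem weyl_smul_sum {ι : Type*} (σ : Weyl H) (s : Finset ι) (f : ι → Dual ℂ H) :
    σ • ∑ i ∈ s, f i = ∑ i ∈ s, σ • f i :=
  map_sum ((rootSystem H).weylGroupRootRep σ) f s

theorem refl_mul_self (i : H.root) : refl i * refl i = 1 := by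
  refine weyl_ext fun μ => ?_
  rw [mul_smul, refl_smul i μ, smul_sub, weyl_smul_smul, refl_smul_root_self, refl_smul, one_smul,
    smul_neg, sub_neg_eq_add, sub_add_cancel]

theorem weyl_induction_refl {p : Weyl H → Prop} (one : p 1) (mem : ∀ i, p (refl i))
    (mul : ∀ σ τ, p σ → p τ → p (σ * τ)) (σ : Weyl H) : p σ := by
  obtain ⟨σ, hσ⟩ := σ
  induction hσ using RootPairing.weylGroup.induction with
  | mem i => exact mem i
  | one => exact one
  | mul x y hx hy h1 h2 => exact mul ⟨x, hx⟩ ⟨y, hy⟩ h1 h2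

theorem dualForm_smul_smul (σ : Weyl H) (μ ν : Dual ℂ H) :
    dualForm H (σ • μ) (σ • ν) = dualForm H μ ν := by
  induction σ using weyl_induction_refl generalizing μ ν with
  | one => simp
  | mem i =>
    rw [refl_smul, refl_smul]
    simp only [map_sub, map_smul, LinearMap.sub_apply, LinearMap.smul_apply, smul_eq_mul]
    rw [dualForm_comm ((rootSystem H).root i) ν, dualForm_root_right μ, dualForm_root_right ν]
    ring
  | mul σ τ h1 h2 => rw [mul_smul, mul_smul, h1, h2]

/-- σ is an isometry, and a coroot is determined by its root and the form; hence σ carries the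
coroot of i to that of j, and the reflection with it. -/
theorem refl_conj {σ : Weyl H} {i j : H.root}
    (h : σ • (rootSystem H).root i = (rootSystem H).root j) :
    σ * refl i = refl j * σ := by
  refine weyl_ext fun μ => ?_
  have hp := dualForm_root_self_pos (H := H) i
  have h1 : dualForm H ((rootSystem H).root j) ((rootSystem H).root j) =
      dualForm H ((rootSystem H).root i) ((rootSystem H).root i) := by
    rw [← h, dualForm_smul_smul]
  have h2 : (σ • μ) ((rootSystem H).coroot j) = μ ((rootSystem H).coroot i) := by
    have h3 := dualForm_root_right (σ • μ) j
    rw [← h, dualForm_smul_smul, h, h1, dualForm_root_right] at h3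
    exact (mul_left_cancel₀ (div_ne_zero hp.ne' two_ne_zero) h3).symm
  rw [mul_smul, mul_smul, refl_smul, refl_smul, smul_sub, weyl_smul_smul, h, h2]

variable (b) in
-- Each root is reached from a simple one by simple reflections and sign changes, and `refl_conj`
-- follows the reflection along.
theorem refl_mem_closure_simple (i : H.root) :
    refl i ∈ Subgroup.closure (refl '' (b.support : Set H.root)) := by
  induction i using b.induction_reflect with
  | h₀ i h =>
    -- `reflectionPerm i i` is the index of the negative root, which has the same reflection.
    have : refl ((rootSystem H).reflectionPerm i i) = refl i := by
      have h1 := refl_conj (refl_smul_root i i)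
      rw [refl_mul_self] at h1
      rw [eq_comm, ← mul_left_inj (refl i), refl_mul_self]
      exact h1
    rwa [this]
  | h₁ i hi => exact Subgroup.subset_closure ⟨i, hi, rfl⟩
  | h₂ i j h hj =>
    have h1 := refl_conj (refl_smul_root j i)
    have h2 : refl ((rootSystem H).reflectionPerm j i) = refl j * refl i * refl j := by
      rw [h1, mul_assoc, refl_mul_self, mul_one]
    rw [h2]
    exact mul_mem (mul_mem (Subgroup.subset_closure ⟨j, hj, rfl⟩) h)
      (Subgroup.subset_closure ⟨j, hj, rfl⟩)

variable (b) in
theorem weyl_induction_simple {p : Weyl H → Prop} (one : p 1)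
    (mul : ∀ i ∈ b.support, ∀ σ, p σ → p (refl i * σ)) (σ : Weyl H) : p σ := by
  have h : σ ∈ Subgroup.closure (refl '' (b.support : Set H.root)) := by
    induction σ using weyl_induction_refl with
    | one => exact one_mem _
    | mem i => exact refl_mem_closure_simple b i
    | mul σ τ h1 h2 => exact mul_mem h1 h2
  induction h using Subgroup.closure_induction_left with
  | one => exact one
  | mul_left x hx y _ hy => obtain ⟨i, hi, rfl⟩ := hx; exact mul i hi y hy
  | inv_mul_cancel x hx y _ hy =>
    obtain ⟨i, hi, rfl⟩ := hx
    rw [inv_eq_of_mul_eq_one_left (refl_mul_self i)]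
    exact mul i hi y hy

theorem isPos_or_exists_neg (i : H.root) :
    b.IsPos i ∨ ∃ j, b.IsPos j ∧ (rootSystem H).root i = -(rootSystem H).root j := by
  let := (rootSystem H).indexNeg
  rcases RootPairing.Base.IsPos.or_neg b i with h | h
  · exact Or.inl h
  · refine Or.inr ⟨-i, h, ?_⟩
    rw [RootPairing.indexNeg_neg, ← refl_smul_root, refl_smul_root_self, neg_neg]

theorem IsPos.root_ne_neg {i j : H.root} (hi : b.IsPos i) (hj : b.IsPos j) :
    (rootSystem H).root i ≠ -(rootSystem H).root j := by
  intro h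
  refine (rootSystem H).ne_zero j
    (eq_zero_of_mem_posCone_of_neg_mem b (root_mem_posCone b hj) ?_)
  rw [← h]
  exact root_mem_posCone b hi

open Classical in
-- A simple reflection negates its own root and permutes the other positive roots.
theorem refl_smul_rho {i : H.root} (hi : i ∈ b.support) :
    refl i • rho b = rho b - (rootSystem H).root i := by
  have hpos := b.isPos_of_mem_support hi
  have h1 : ∑ j with b.IsPos j, (rootSystem H).root j = (rootSystem H).root i +
      ∑ j with b.IsPos j ∧ j ≠ i, (rootSystem H).root j := by
    rw [← Finset.filter_filter, Finset.filter_ne', Finset.add_sum_erase]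
    simpa using hpos
  have h2 : ∑ j with b.IsPos j ∧ j ≠ i,
      (rootSystem H).root ((rootSystem H).reflectionPerm i j) =
        ∑ j with b.IsPos j ∧ j ≠ i, (rootSystem H).root j := by
    have hself : ∀ j, (rootSystem H).reflectionPerm i ((rootSystem H).reflectionPerm i j) = j :=
      fun j => by simp
    have hmem : ∀ j, b.IsPos j ∧ j ≠ i → b.IsPos ((rootSystem H).reflectionPerm i j) ∧
        (rootSystem H).reflectionPerm i j ≠ i := by
      rintro j ⟨h, hne⟩
      refine ⟨h.reflectionPerm hi hne, fun h' => ?_⟩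
      have h3 := refl_smul_root i ((rootSystem H).reflectionPerm i j)
      rw [hself, h', refl_smul_root_self] at h3
      exact IsPos.root_ne_neg h hpos h3.symm
    refine Finset.sum_bij' (fun j _ => (rootSystem H).reflectionPerm i j)
      (fun j _ => (rootSystem H).reflectionPerm i j) ?_ ?_ ?_ ?_ ?_
    · intro j hj; simpa using hmem j (by simpa using hj)
    · intro j hj; simpa using hmem j (by simpa using hj)
    · intro j _; exact hself j
    · intro j _; exact hself j
    · intro j _; rfl
  rw [rho, weyl_smul_smul, h1, smul_add, weyl_smul_sum, refl_smul_root_self]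
  simp only [refl_smul_root]
  rw [h2]
  module

theorem rho_apply_coroot {i : H.root} (hi : i ∈ b.support) :
    rho b ((rootSystem H).coroot i) = 1 := by
  have h := refl_smul_rho hi
  rw [refl_smul, sub_right_inj] at h
  have h2 : (rho b ((rootSystem H).coroot i) - 1) • (rootSystem H).root i = 0 := by
    rw [sub_smul, h, one_smul, sub_self]
  exact sub_eq_zero.mp ((smul_eq_zero.mp h2).resolve_right ((rootSystem H).ne_zero i))

/-- Let the letters act one at a time, from the right. At the letter where the root first turns
negative it must equal the simple root of that letter, since a simple reflection makes no other
positive root negative. -/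
theorem exists_split_of_neg (l : List H.root) (hl : ∀ i ∈ l, i ∈ b.support) {k m : H.root}
    (hk : b.IsPos k) (hm : b.IsPos m)
    (h : (l.map refl).prod • (rootSystem H).root k = -(rootSystem H).root m) :
    ∃ l₁ j l₂, l = l₁ ++ j :: l₂ ∧
      (l₂.map refl).prod • (rootSystem H).root k = (rootSystem H).root j := by
  induction l generalizing m with
  | nil => exact absurd (by simpa using h) (IsPos.root_ne_neg hk hm)
  | cons i t ih =>
    rw [List.map_cons, List.prod_cons, mul_smul, RootPairing.weylGroup_apply_root] at h
    obtain ⟨γ, hγ⟩ : ∃ γ, (t.map refl).prod • (rootSystem H).root k = (rootSystem H).root γ :=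
      ⟨_, RootPairing.weylGroup_apply_root _ _ _⟩
    rw [← RootPairing.weylGroup_apply_root, hγ, refl_smul_root] at h
    have hi : i ∈ b.support := hl i (by simp)
    rcases isPos_or_exists_neg (b := b) γ with hp | ⟨δ, hδ, hγδ⟩
    · rcases eq_or_ne γ i with rfl | hne
      · exact ⟨[], γ, t, rfl, hγ⟩
      · exact absurd h (IsPos.root_ne_neg (hp.reflectionPerm hi hne) hm)
    · obtain ⟨l₁, j, l₂, rfl, h2⟩ := ih (fun i hi => hl i (by simp [hi])) hδ (hγ.trans hγδ)
      exact ⟨i :: l₁, j, l₂, rfl, h2⟩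

/-- The last letter k negates its own root, so the rest of the word sends that positive root to a
negative one. By `exists_split_of_neg` some suffix carries it to the simple root of the preceding
letter j; conjugation then cancels j against k and leaves a word shorter by two for the same
element. -/
theorem prod_refl_eq_one (n : ℕ) (l : List H.root) (hn : l.length = n)
    (hl : ∀ i ∈ l, i ∈ b.support)
    (h : ∀ i, b.IsPos i → ∃ j, b.IsPos j ∧
      (l.map refl).prod • (rootSystem H).root i = (rootSystem H).root j) :
    (l.map refl).prod = 1 := by
  induction n using Nat.strong_induction_on generalizing l with
  | _ n ih =>
  rcases List.eq_nil_or_concat l with rfl | ⟨l₀, k, rfl⟩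
  · simp
  have hk : b.IsPos k := b.isPos_of_mem_support (hl k (by simp))
  obtain ⟨m, hm, hkm⟩ := h k hk
  rw [List.concat_eq_append] at *
  have h0 : (l₀.map refl).prod • (rootSystem H).root k = -(rootSystem H).root m := by
    rw [List.map_append, List.prod_append, mul_smul] at hkm
    rw [← hkm, List.map_singleton, List.prod_singleton, refl_smul_root_self, smul_neg, neg_neg]
  obtain ⟨l₁, j, l₂, rfl, h2⟩ := exists_split_of_neg l₀ (fun i hi => hl i (by simp [hi])) hk hm h0
  have h3 : (((l₁ ++ j :: l₂) ++ [k]).map refl).prod = ((l₁ ++ l₂).map refl).prod := by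
    simp only [List.map_append, List.prod_append, List.map_cons, List.prod_cons, List.map_nil,
      List.prod_nil, mul_one]
    rw [mul_assoc, mul_assoc, refl_conj h2, ← mul_assoc (refl j) (refl j), refl_mul_self, one_mul]
  rw [h3]
  refine ih _ ?_ (l₁ ++ l₂) rfl (fun i hi => hl i ?_) (by rwa [h3] at h)
  · rw [← hn]; simp
  · simp only [List.mem_append, List.mem_cons] at hi ⊢; tauto

/-- A root is positive exactly when its product with ρ is, and σ preserves the form; so an element
fixing ρ keeps positive roots positive. -/
theorem eq_one_of_smul_rho_eq {σ : Weyl H} (h : σ • rho b = rho b) : σ = 1 := by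
  obtain ⟨l, hl, rfl⟩ : ∃ l : List H.root, (∀ i ∈ l, i ∈ b.support) ∧ (l.map refl).prod = σ := by
    clear h
    induction σ using weyl_induction_simple b with
    | one => exact ⟨[], by simp, rfl⟩
    | mul i hi σ ih =>
      obtain ⟨l, hl, rfl⟩ := ih
      exact ⟨i :: l, List.forall_mem_cons.mpr ⟨hi, hl⟩, by simp⟩
  refine prod_refl_eq_one _ l rfl hl fun i hi => ?_
  obtain ⟨γ, hγ⟩ : ∃ γ, (l.map refl).prod • (rootSystem H).root i = (rootSystem H).root γ :=
      ⟨_, RootPairing.weylGroup_apply_root _ _ _⟩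
  have hpos : ∀ {j}, b.IsPos j → 0 < dualForm H (rho b) ((rootSystem H).root j) := fun {j} hj =>
    dualForm_pos_of_mem_posCone (root_mem_posCone b hj) ((rootSystem H).ne_zero j) fun k hk => by
      rw [rho_apply_coroot hk]; exact zero_lt_one
  rcases isPos_or_exists_neg (b := b) γ with hp | ⟨δ, hδ, hγδ⟩
  · exact ⟨γ, hp, hγ⟩
  · exfalso
    have h1 := dualForm_smul_smul (l.map refl).prod (rho b) ((rootSystem H).root i)
    rw [h, hγ, hγδ, map_neg] at h1
    have h2 := hpos hi
    rw [← h1] at h2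
    exact lt_asymm (hpos hδ) (neg_pos.mp h2)

theorem weylSign_one : weylSign (1 : Weyl H) = 1 := by
  simp [weylSign]

theorem weylSign_mul (σ τ : Weyl H) : weylSign (σ * τ) = weylSign σ * weylSign τ := by
  simp [weylSign]

theorem weylSign_refl (i : H.root) : weylSign (refl i) = -1 := by
  -- A map x ↦ x + f(x)v has determinant 1 + f(v), here 1 - 2.
  have h : (rootSystem H).weylGroupRootRep (refl i) = LinearMap.transvection
      (-(LinearMap.toSpanSingleton ℂ _ 1).comp (Dual.eval ℂ H ((rootSystem H).coroot i)))
      ((rootSystem H).root i) := by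
    ext1 μ
    change refl i • μ = _
    rw [refl_smul, LinearMap.transvection.apply]
    simp [sub_eq_add_neg]
  rw [weylSign, h, LinearMap.transvection.det]
  simp only [LinearMap.neg_apply, LinearMap.comp_apply, Dual.eval_apply, root_apply_coroot_self]
  norm_num

end

/-! ### The Weyl denominator formula -/

section

variable {b : (rootSystem H).Base}

open scoped ComplexOrder

theorem coeff_single_mul_sub {R M : Type*} [Semiring R] [AddCommGroup M] (x : AddMonoidAlgebra R M)
    (r : R) (m ν : M) : (AddMonoidAlgebra.single m r * x).coeff ν = r * x.coeff (ν - m) := by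
  have := AddMonoidAlgebra.coeff_single_mul_add x r m (ν - m)
  rwa [add_sub_cancel] at this

theorem sub_mul_coeff_apply (x : AddMonoidAlgebra ℂ (Dual ℂ H)) (α ν : Dual ℂ H) :
    ((1 - AddMonoidAlgebra.single (-α) (1 : ℂ)) * x).coeff ν = x.coeff ν - x.coeff (ν + α) := by
  rw [sub_mul, one_mul, AddMonoidAlgebra.coeff_sub, Finsupp.sub_apply, coeff_single_mul_sub,
    one_mul, sub_neg_eq_add]

/-- The action of the Weyl group on the group ring of the dual of `H`. -/
def weylAct (σ : Weyl H) : AddMonoidAlgebra ℂ (Dual ℂ H) →+* AddMonoidAlgebra ℂ (Dual ℂ H) :=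
  AddMonoidAlgebra.mapDomainRingHom ℂ (DistribSMul.toAddMonoidHom (Dual ℂ H) σ)

theorem weylAct_single (σ : Weyl H) (μ : Dual ℂ H) (r : ℂ) :
    weylAct σ (AddMonoidAlgebra.single μ r) = AddMonoidAlgebra.single (σ • μ) r :=
  AddMonoidAlgebra.mapDomain_single

theorem coeff_weylAct (σ : Weyl H) (x : AddMonoidAlgebra ℂ (Dual ℂ H)) (ν : Dual ℂ H) :
    (weylAct σ x).coeff (σ • ν) = x.coeff ν :=
  Finsupp.mapDomain_apply (MulAction.injective σ) x.coeff ν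

variable (b)

open Classical in
/-- The set of positive roots. -/
def posRoots : Finset H.root := Finset.univ.filter b.IsPos

variable {b} in
theorem mem_posRoots {i : H.root} : i ∈ posRoots b ↔ b.IsPos i := by
  simp [posRoots]

/-- The Weyl denominator `e_ρ ∏_{α > 0} (1 - e_{-α})`. -/
def weylDenominator : AddMonoidAlgebra ℂ (Dual ℂ H) :=
  AddMonoidAlgebra.single (rho b) 1 *
    ∏ i ∈ posRoots b, (1 - AddMonoidAlgebra.single (-(rootSystem H).root i) (1 : ℂ))

variable {b}

/-- The factors of the positive roots other than α = α_i are permuted, and what remains is e_{ρ-α}(1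
- e_α) = -e_ρ(1 - e_{-α}). -/
theorem weylAct_refl_weylDenominator {i : H.root} (hi : i ∈ b.support) :
    weylAct (refl i) (weylDenominator b) = -weylDenominator b := by
  classical
  have hpos := b.isPos_of_mem_support hi
  have h2 : ∏ j ∈ (posRoots b).erase i,
      (1 - AddMonoidAlgebra.single (-(rootSystem H).root ((rootSystem H).reflectionPerm i j))
        (1 : ℂ)) =
        ∏ j ∈ (posRoots b).erase i,
          (1 - AddMonoidAlgebra.single (-(rootSystem H).root j) (1 : ℂ)) := by
    have hself : ∀ j, (rootSystem H).reflectionPerm i ((rootSystem H).reflectionPerm i j) = j :=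
      fun j => by simp
    have hmem : ∀ j, j ∈ (posRoots b).erase i →
        (rootSystem H).reflectionPerm i j ∈ (posRoots b).erase i := by
      intro j hj
      rw [Finset.mem_erase, mem_posRoots] at hj ⊢
      refine ⟨fun h' => ?_, hj.2.reflectionPerm hi hj.1⟩
      have h3 := refl_smul_root i ((rootSystem H).reflectionPerm i j)
      rw [hself, h', refl_smul_root_self] at h3
      exact IsPos.root_ne_neg hj.2 hpos h3.symm
    exact Finset.prod_bij' (fun j _ => (rootSystem H).reflectionPerm i j)
      (fun j _ => (rootSystem H).reflectionPerm i j) hmem hmem (fun j _ => hself j)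
      (fun j _ => hself j) fun j _ => rfl
  rw [weylDenominator, ← Finset.mul_prod_erase _ _ (mem_posRoots.mpr hpos), map_mul, map_mul,
    map_prod]
  simp only [map_sub, map_one, weylAct_single, smul_neg, refl_smul_root_self, neg_neg,
    refl_smul_root, refl_smul_rho hi]
  rw [h2, ← mul_assoc, ← mul_assoc, ← neg_mul]
  congr 1
  rw [mul_sub, mul_sub, AddMonoidAlgebra.single_mul_single, AddMonoidAlgebra.single_mul_single]
  simp [sub_eq_add_neg]

theorem coeff_weylDenominator_smul (σ : Weyl H) (ν : Dual ℂ H) :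
    (weylDenominator b).coeff (σ • ν) = weylSign σ * (weylDenominator b).coeff ν := by
  induction σ using weyl_induction_simple b with
  | one => rw [one_smul, weylSign_one, one_mul]
  | mul i hi σ ih =>
    have h := coeff_weylAct (refl i) (weylDenominator b) (σ • ν)
    rw [weylAct_refl_weylDenominator hi, ih] at h
    rw [mul_smul, weylSign_mul, weylSign_refl, mul_assoc, ← h]
    simp

/-- Multiplication by 1 - e_{-α} with α positive only adds terms strictly lower in the cone order,
so the leading term and the cone bound both survive. -/
theorem coeff_prod_one_sub_mul (s : Finset H.root) (hs : ∀ i ∈ s, b.IsPos i)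
    {x : AddMonoidAlgebra ℂ (Dual ℂ H)} {lam : Dual ℂ H} (h0 : x.coeff lam = 1)
    (h1 : ∀ ν, lam - ν ∉ posCone b → x.coeff ν = 0) :
    ((∏ i ∈ s, (1 - AddMonoidAlgebra.single (-(rootSystem H).root i) (1 : ℂ))) * x).coeff lam = 1 ∧
    ∀ ν, lam - ν ∉ posCone b → ((∏ i ∈ s,
      (1 - AddMonoidAlgebra.single (-(rootSystem H).root i) (1 : ℂ))) * x).coeff ν = 0 := by
  classical
  induction s using Finset.induction_on with
  | empty => simpa using ⟨h0, h1⟩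
  | insert i s hi ih =>
    obtain ⟨h0, h1⟩ := ih fun j hj => hs j (Finset.mem_insert_of_mem hj)
    have hi' := root_mem_posCone b (hs i (Finset.mem_insert_self i s))
    rw [Finset.prod_insert hi, mul_assoc]
    constructor
    · rw [sub_mul_coeff_apply, h0, h1, sub_zero]
      refine fun h => (rootSystem H).ne_zero i (eq_zero_of_mem_posCone_of_neg_mem b hi' ?_)
      rwa [sub_add_cancel_left] at h
    · intro ν hν
      rw [sub_mul_coeff_apply, h1 ν hν, h1, sub_zero]
      intro h
      apply hν
      have := add_mem h hi'
      rwa [show lam - (ν + (rootSystem H).root i) + (rootSystem H).root i = lam - ν by abel] at this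

theorem coeff_prod_one_sub (s : Finset H.root) (hs : ∀ i ∈ s, b.IsPos i) :
    (∏ i ∈ s, (1 - AddMonoidAlgebra.single (-(rootSystem H).root i) (1 : ℂ))).coeff 0 = 1 ∧
    ∀ ν, 0 - ν ∉ posCone b →
      (∏ i ∈ s, (1 - AddMonoidAlgebra.single (-(rootSystem H).root i) (1 : ℂ))).coeff ν = 0 := by
  have h := coeff_prod_one_sub_mul s hs (x := 1) (lam := 0) (by simp) fun ν hν => by
    classical
    rw [AddMonoidAlgebra.one_def, AddMonoidAlgebra.coeff_single, Finsupp.single_apply, if_neg]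
    rintro rfl
    exact hν (by simp)
  rwa [mul_one] at h

theorem coeff_weylDenominator_rho : (weylDenominator b).coeff (rho b) = 1 := by
  rw [weylDenominator, coeff_single_mul_sub, sub_self, one_mul]
  exact (coeff_prod_one_sub _ fun i => mem_posRoots.mp).1

theorem sub_mem_posCone_of_coeff_weylDenominator_ne_zero {ν : Dual ℂ H}
    (h : (weylDenominator b).coeff ν ≠ 0) : rho b - ν ∈ posCone b := by
  by_contra hν
  rw [weylDenominator, coeff_single_mul_sub, one_mul] at h
  exact h ((coeff_prod_one_sub _ fun i => mem_posRoots.mp).2 _ (by simpa using hν))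

theorem exists_int_apply_coroot_of_mem_posCone {β : Dual ℂ H} (hβ : β ∈ posCone b) (j : H.root) :
    ∃ n : ℤ, β ((rootSystem H).coroot j) = n := by
  induction hβ using AddSubmonoid.closure_induction with
  | mem x hx =>
    obtain ⟨i, hi, rfl⟩ := hx
    exact ⟨_, root_apply_coroot_eq_intCast i j⟩
  | zero => exact ⟨0, by simp⟩
  | add x y _ _ hx hy =>
    obtain ⟨r, hr⟩ := hx
    obtain ⟨s, hs⟩ := hy
    exact ⟨r + s, by simp only [LinearMap.add_apply]; rw [hr, hs]; simp⟩

/-- Maximal height makes ν nonnegative on simple coroots; antisymmetry excludes the value 0, since a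
reflection fixing ν would equate its coefficient with its negative. Integrality gives values at
least 1, so ν - ρ is dominant. With β = ρ - ν in the cone this reads -(β,β) ≥ 0, hence β = 0. -/
theorem eq_rho_of_coeff_weylDenominator_ne_zero {ν : Dual ℂ H}
    (h : (weylDenominator b).coeff ν ≠ 0)
    (hmax : ∀ i ∈ b.support, (heightFun b (refl i • ν)).re ≤ (heightFun b ν).re) :
    ν = rho b := by
  have hβ := sub_mem_posCone_of_coeff_weylDenominator_ne_zero h
  have key : ∀ i ∈ b.support, 0 ≤ (ν - rho b) ((rootSystem H).coroot i) := by
    intro i hi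
    obtain ⟨n, hn⟩ := exists_int_apply_coroot_of_mem_posCone hβ i
    have h1 : ν ((rootSystem H).coroot i) = (1 - n : ℤ) := by
      have h2 : ν = rho b - (rho b - ν) := by abel
      rw [h2, LinearMap.sub_apply, hn, rho_apply_coroot hi]
      simp
    have hm := hmax i hi
    rw [refl_smul, h1, map_sub, map_smul, heightFun_simple b hi] at hm
    have h3 : (0 : ℝ) ≤ (1 - n : ℤ) := by
      simp only [smul_eq_mul, mul_one, Complex.sub_re, Complex.intCast_re] at hm
      linarith
    have h4 : (1 - n : ℤ) ≠ 0 := by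
      intro h0
      have h5 := coeff_weylDenominator_smul (b := b) (refl i) ν
      rw [refl_smul, h1, h0, weylSign_refl] at h5
      simp only [Int.cast_zero, zero_smul, sub_zero] at h5
      apply h
      linear_combination h5 / 2
    have h6 : (1 : ℤ) ≤ 1 - n := by
      have : (0 : ℤ) ≤ 1 - n := by exact_mod_cast h3
      omega
    rw [LinearMap.sub_apply, h1, rho_apply_coroot hi, sub_nonneg]
    exact_mod_cast h6
  have h7 := dualForm_nonneg_of_mem_posCone hβ key
  rw [← neg_sub (rho b) ν, map_neg, LinearMap.neg_apply, Left.nonneg_neg_iff] at h7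
  exact (sub_eq_zero.mp (eq_zero_of_dualForm_self_nonpos hβ h7)).symm

theorem exists_smul_rho_of_coeff_weylDenominator_ne_zero {ν : Dual ℂ H}
    (h : (weylDenominator b).coeff ν ≠ 0) : ∃ σ : Weyl H, σ • rho b = ν := by
  -- Antisymmetry keeps the whole orbit of ν in the support, so ν may be replaced by its highest
  -- conjugate.
  obtain ⟨σ, hσ⟩ := Finite.exists_max fun σ : Weyl H => (heightFun b (σ • ν)).re
  have h1 : σ • ν = rho b := by
    apply eq_rho_of_coeff_weylDenominator_ne_zero
    · intro h0
      apply h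
      have := coeff_weylDenominator_smul (b := b) σ⁻¹ (σ • ν)
      rwa [inv_smul_smul, h0, mul_zero] at this
    · intro i _
      rw [← mul_smul]
      exact hσ _
  exact ⟨σ⁻¹, by rw [← h1, inv_smul_smul]⟩

/-- Antisymmetry fixes the coefficients on the orbit of ρ from the leading one, there are no others,
and the exponents σρ are distinct because ρ has trivial stabiliser. -/
theorem weylDenominator_eq_sum :
    weylDenominator b = ∑ σ : Weyl H, AddMonoidAlgebra.single (σ • rho b) (weylSign σ) := by
  classical
  ext ν
  rw [AddMonoidAlgebra.coeff_sum, Finsupp.finsetSum_apply]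
  simp only [AddMonoidAlgebra.coeff_single, Finsupp.single_apply]
  by_cases h : ∃ σ : Weyl H, σ • rho b = ν
  · obtain ⟨σ, rfl⟩ := h
    rw [coeff_weylDenominator_smul, coeff_weylDenominator_rho, mul_one,
      Finset.sum_eq_single σ, if_pos rfl]
    · intro τ _ hτ
      rw [if_neg]
      intro h
      apply hτ
      have : σ⁻¹ * τ = 1 := eq_one_of_smul_rho_eq (b := b) (by rw [mul_smul, h, inv_smul_smul])
      exact (inv_mul_eq_one.mp this).symm
    · simp
  · rw [Finset.sum_eq_zero]
    · by_contra h0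
      exact h (exists_smul_rho_of_coeff_weylDenominator_ne_zero h0)
    · exact fun σ _ => if_neg fun h' => h ⟨σ, h'⟩

end

/-! ### Dual bases for the Killing form and the Casimir element -/

section

variable {b : (rootSystem H).Base}

theorem cartan_root_induction {p : L → Prop} (cartan : ∀ h : H, p h)
    (root : ∀ i : H.root, ∀ x ∈ LieAlgebra.rootSpace H ((rootSystem H).root i : H → ℂ), p x)
    (add : ∀ x y, p x → p y → p (x + y)) (z : L) : p z := by
  have hz : z ∈ ⨆ χ : LieModule.Weight ℂ H L, LieAlgebra.rootSpace H χ := by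
    rw [LieModule.iSup_genWeightSpace_eq_top' ℂ H L]; trivial
  induction hz using LieSubmodule.iSup_induction' with
  | mem χ x hx =>
    by_cases hχ : χ.IsZero
    · rw [hχ.eq, LieAlgebra.rootSpace_zero_eq] at hx
      exact cartan ⟨x, hx⟩
    · exact root ⟨χ, by simpa using hχ⟩ x hx
  | zero => exact cartan 0
  | add x y _ _ hx hy => exact add x y hx hy

theorem exists_rootVectors (i : H.root) :
    ∃ e ∈ LieAlgebra.rootSpace H ((rootSystem H).root i : H → ℂ),
      ∃ f ∈ LieAlgebra.rootSpace H (-((rootSystem H).root i : H → ℂ)),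
        killingForm ℂ L e f = 1 := by
  have hi : (i : LieModule.Weight ℂ H L).IsNonZero := H.isNonZero_coe_root i
  obtain ⟨h, e, f, t, he, hf⟩ := exists_isSl2Triple_of_weight_isNonZero hi
  have h1 := lie_eq_killingForm_smul_of_mem_rootSpace_of_mem_rootSpace_neg he hf
  have h2 : killingForm ℂ L e f ≠ 0 := by
    intro h0
    rw [t.lie_e_f, h0, zero_smul] at h1
    exact t.h_ne_zero h1
  refine ⟨e, he, (killingForm ℂ L e f)⁻¹ • f, Submodule.smul_mem _ _ hf, ?_⟩
  rw [map_smul, smul_eq_mul, inv_mul_cancel₀ h2]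

/-- A root vector for the root `i`. -/
def rootE (i : H.root) : L := (exists_rootVectors i).choose

/-- A root vector for the root `-i`, dual to `rootE i` under the Killing form. -/
def rootF (i : H.root) : L := (exists_rootVectors i).choose_spec.2.choose

theorem rootE_mem (i : H.root) :
    rootE i ∈ LieAlgebra.rootSpace H ((rootSystem H).root i : H → ℂ) :=
  (exists_rootVectors i).choose_spec.1

theorem rootF_mem (i : H.root) :
    rootF i ∈ LieAlgebra.rootSpace H (-((rootSystem H).root i : H → ℂ)) :=
  (exists_rootVectors i).choose_spec.2.choose_spec.1

theorem killingForm_rootE_rootF (i : H.root) : killingForm ℂ L (rootE i) (rootF i) = 1 :=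
  (exists_rootVectors i).choose_spec.2.choose_spec.2

theorem lie_rootE_rootF (i : H.root) :
    ⁅rootE i, rootF i⁆ = ((cartanEquivDual H).symm ((rootSystem H).root i) : L) := by
  have := lie_eq_killingForm_smul_of_mem_rootSpace_of_mem_rootSpace_neg
    (α := (i : LieModule.Weight ℂ H L)) (rootE_mem i) (rootF_mem i)
  rw [killingForm_rootE_rootF, one_smul] at this
  exact this

theorem killingForm_eq_zero_of_cartan_root (h : H) {χ : H → ℂ} (hχ : χ ≠ 0) {x : L}
    (hx : x ∈ LieAlgebra.rootSpace H χ) : killingForm ℂ L h x = 0 := by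
  refine LieAlgebra.killingForm_apply_eq_zero_of_mem_rootSpace_of_add_ne_zero ℂ L H (α := 0)
    (β := χ) ?_ hx (by simpa using hχ)
  rw [LieAlgebra.rootSpace_zero_eq]
  exact h.2

theorem coe_root_ne_zero (i : H.root) : ((rootSystem H).root i : H → ℂ) ≠ 0 := fun h =>
  (rootSystem H).ne_zero i (DFunLike.coe_injective h)

theorem eq_smul_of_mem_rootSpace {i : H.root} {x y : L}
    (hx : x ∈ LieAlgebra.rootSpace H ((rootSystem H).root i : H → ℂ)) (hx0 : x ≠ 0)
    (hy : y ∈ LieAlgebra.rootSpace H ((rootSystem H).root i : H → ℂ)) : ∃ c : ℂ, c • x = y := by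
  have h1 := finrank_rootSpace_eq_one (K := ℂ) (i : LieModule.Weight ℂ H L)
    (H.isNonZero_coe_root i)
  obtain ⟨c, hc⟩ := (finrank_eq_one_iff_of_nonzero' (K := ℂ)
    (⟨x, hx⟩ : LieAlgebra.rootSpace H (i : LieModule.Weight ℂ H L))
    (fun h => hx0 (congrArg Subtype.val h))).mp h1 ⟨y, hy⟩
  exact ⟨c, congrArg Subtype.val hc⟩

variable (H) in
/-- The first family in the Casimir element. -/
def casimirFst (b : (rootSystem H).Base) :
    Fin (finrank ℂ H) ⊕ posRoots b ⊕ posRoots b → L :=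
  Sum.elim (fun k => (finBasis ℂ H k : L)) (Sum.elim (fun i => rootE i.1) fun i => rootF i.1)

variable (H) in
/-- The second family in the Casimir element, dual to the first one under the Killing form. -/
def casimirSnd (b : (rootSystem H).Base) :
    Fin (finrank ℂ H) ⊕ posRoots b ⊕ posRoots b → L :=
  Sum.elim (fun k => ((cartanEquivDual H).symm ((finBasis ℂ H).coord k) : L))
    (Sum.elim (fun i => rootF i.1) fun i => rootE i.1)

theorem killingForm_cartanEquivDual_symm (f : Dual ℂ H) (z : H) :
    killingForm ℂ L ((cartanEquivDual H).symm f) z = f z := by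
  conv_rhs => rw [← (cartanEquivDual H).apply_symm_apply f]
  rfl

theorem rootE_ne_zero (i : H.root) : rootE i ≠ 0 := fun h => by
  simpa [h] using killingForm_rootE_rootF i

theorem rootF_ne_zero (i : H.root) : rootF i ≠ 0 := fun h => by
  simpa [h] using killingForm_rootE_rootF i

theorem killingForm_comm (x y : L) : killingForm ℂ L x y = killingForm ℂ L y x :=
  LieModule.traceForm_comm ℂ L L x y

/-- Root spaces are orthogonal unless their roots are opposite, so on each one-dimensional root
space a single term survives, and on the Cartan subalgebra only the `finBasis` terms do. -/
theorem sum_killingForm_casimir (b : (rootSystem H).Base) (z : L) :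
    ∑ s, killingForm ℂ L (casimirSnd H b s) z • casimirFst H b s = z := by
  classical
  simp only [Fintype.sum_sum_type, casimirFst, casimirSnd, Sum.elim_inl, Sum.elim_inr]
  have hcR : ∀ (h : H) (i : H.root), killingForm ℂ L (rootE i) h = 0 := fun h i => by
    rw [killingForm_comm]
    exact killingForm_eq_zero_of_cartan_root h (coe_root_ne_zero i) (rootE_mem i)
  have hcF : ∀ (h : H) (i : H.root), killingForm ℂ L (rootF i) h = 0 := fun h i => by
    rw [killingForm_comm]
    exact killingForm_eq_zero_of_cartan_root h (neg_ne_zero.mpr (coe_root_ne_zero i)) (rootF_mem i)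
  have hEE : ∀ i j : H.root, b.IsPos i → b.IsPos j → killingForm ℂ L (rootE i) (rootE j) = 0 :=
    fun i j hi hj => LieAlgebra.killingForm_apply_eq_zero_of_mem_rootSpace_of_add_ne_zero ℂ L H
      (rootE_mem i) (rootE_mem j) fun h => IsPos.root_ne_neg hi hj
        (eq_neg_of_add_eq_zero_left (DFunLike.coe_injective h))
  have hFF : ∀ i j : H.root, b.IsPos i → b.IsPos j → killingForm ℂ L (rootF i) (rootF j) = 0 :=
    fun i j hi hj => LieAlgebra.killingForm_apply_eq_zero_of_mem_rootSpace_of_add_ne_zero ℂ L H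
      (rootF_mem i) (rootF_mem j) fun h => IsPos.root_ne_neg hi hj
        (eq_neg_of_add_eq_zero_left (DFunLike.coe_injective (by
          rw [← neg_add, neg_eq_zero] at h; exact h)))
  have hFE : ∀ i j : H.root, i ≠ j → killingForm ℂ L (rootF i) (rootE j) = 0 :=
    fun i j hij => LieAlgebra.killingForm_apply_eq_zero_of_mem_rootSpace_of_add_ne_zero ℂ L H
      (rootF_mem i) (rootE_mem j) fun h => hij ((rootSystem H).root.injective
        (DFunLike.coe_injective (neg_add_eq_zero.mp h)))
  have hEF : ∀ i j : H.root, i ≠ j → killingForm ℂ L (rootE i) (rootF j) = 0 :=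
    fun i j hij => by rw [killingForm_comm]; exact hFE j i hij.symm
  have hpe : ∀ {i}, b.IsPos i →
      (∑ k, killingForm ℂ L ((cartanEquivDual H).symm ((finBasis ℂ H).coord k)) (rootE i) •
        (finBasis ℂ H k : L)) +
      ((∑ j : posRoots b, killingForm ℂ L (rootF j.1) (rootE i) • rootE j.1) +
      ∑ j : posRoots b, killingForm ℂ L (rootE j.1) (rootE i) • rootF j.1) = rootE i := by
    intro i hi
    rw [Finset.sum_eq_zero fun k _ => by
        rw [killingForm_eq_zero_of_cartan_root _ (coe_root_ne_zero i) (rootE_mem i), zero_smul],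
      Finset.sum_eq_single ⟨i, mem_posRoots.mpr hi⟩ (fun j _ hj => by
        rw [hFE j i fun h => hj (Subtype.ext h), zero_smul]) (by simp),
      Finset.sum_eq_zero (fun j _ => by rw [hEE j i (mem_posRoots.mp j.2) hi, zero_smul]),
      killingForm_comm, killingForm_rootE_rootF]
    simp
  have hpf : ∀ {i}, b.IsPos i →
      (∑ k, killingForm ℂ L ((cartanEquivDual H).symm ((finBasis ℂ H).coord k)) (rootF i) •
        (finBasis ℂ H k : L)) +
      ((∑ j : posRoots b, killingForm ℂ L (rootF j.1) (rootF i) • rootE j.1) +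
      ∑ j : posRoots b, killingForm ℂ L (rootE j.1) (rootF i) • rootF j.1) = rootF i := by
    intro i hi
    rw [Finset.sum_eq_zero fun k _ => by
        rw [killingForm_eq_zero_of_cartan_root _ (neg_ne_zero.mpr (coe_root_ne_zero i))
          (rootF_mem i), zero_smul],
      Finset.sum_eq_zero (fun j _ => by rw [hFF j i (mem_posRoots.mp j.2) hi, zero_smul]),
      Finset.sum_eq_single ⟨i, mem_posRoots.mpr hi⟩ (fun j _ hj => by
        rw [hEF j i fun h => hj (Subtype.ext h), zero_smul]) (by simp),
      killingForm_rootE_rootF]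
    simp
  induction z using cartan_root_induction (H := H) with
  | cartan h =>
    simp only [hcR, hcF, zero_smul, Finset.sum_const_zero, add_zero,
      killingForm_cartanEquivDual_symm]
    have := congrArg (Subtype.val : H → L) ((finBasis ℂ H).sum_repr h)
    rw [AddSubmonoidClass.coe_finsetSum] at this
    exact this
  | root i x hx =>
    rcases isPos_or_exists_neg (b := b) i with hi | ⟨j, hj, hij⟩
    · obtain ⟨c, rfl⟩ := eq_smul_of_mem_rootSpace (rootE_mem i) (rootE_ne_zero i) hx
      simp only [map_smul, smul_assoc, ← Finset.smul_sum, ← smul_add]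
      rw [hpe hi]
    · have hF : rootF j ∈ LieAlgebra.rootSpace H ((rootSystem H).root i : H → ℂ) := by
        rw [hij]; exact rootF_mem j
      obtain ⟨c, rfl⟩ := eq_smul_of_mem_rootSpace hF (rootF_ne_zero j) hx
      simp only [map_smul, smul_assoc, ← Finset.smul_sum, ← smul_add]
      rw [hpf hj]
  | add x y hx hy =>
    simp only [map_add, add_smul, Finset.sum_add_distrib] at hx hy ⊢
    conv_rhs => rw [← hx, ← hy]
    abel

section Casimir

variable {V : Type*} [AddCommGroup V] [Module ℂ V] [LieRingModule L V] [LieModule ℂ L V]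

/-- The Casimir operator commutes with the action: expanding [z, x_s] and [z, y_s] in the dual
families gives coefficients that cancel by invariance of the Killing form. -/
theorem lie_sum_lie_of_dual {ι : Type*} [Fintype ι] {x y : ι → L}
    (hxy : ∀ z, ∑ s, killingForm ℂ L (y s) z • x s = z) (z : L) (v : V) :
    ⁅z, ∑ s, ⁅x s, ⁅y s, v⁆⁆⁆ = ∑ s, ⁅x s, ⁅y s, ⁅z, v⁆⁆⁆ := by
  -- Duality with the two families exchanged, from symmetry and nondegeneracy.
  have hyx : ∀ z, ∑ s, killingForm ℂ L (x s) z • y s = z := by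
    intro z
    have hnd := LieAlgebra.IsKilling.killingForm_nondegenerate ℂ L
    rw [← sub_eq_zero]
    refine hnd.1 _ fun u => ?_
    rw [map_sub, LinearMap.sub_apply, sub_eq_zero]
    conv_rhs => rw [← hxy u]
    simp only [map_sum, map_smul, LinearMap.sum_apply, LinearMap.smul_apply, smul_eq_mul]
    refine Finset.sum_congr rfl fun s _ => ?_
    rw [mul_comm, killingForm_comm z]
  have h1 : ∀ s, ⁅⁅z, x s⁆, ⁅y s, v⁆⁆ =
      ∑ r, killingForm ℂ L (y r) ⁅z, x s⁆ • ⁅x r, ⁅y s, v⁆⁆ := fun s => by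
    conv_lhs => rw [← hxy ⁅z, x s⁆]
    rw [sum_lie]
    simp only [smul_lie]
  have h2 : ∀ r, ⁅x r, ⁅⁅z, y r⁆, v⁆⁆ =
      ∑ s, killingForm ℂ L (x s) ⁅z, y r⁆ • ⁅x r, ⁅y s, v⁆⁆ := fun r => by
    conv_lhs => rw [← hyx ⁅z, y r⁆]
    rw [sum_lie, lie_sum]
    simp only [smul_lie, lie_smul]
  have h3 : ∑ s, ⁅⁅z, x s⁆, ⁅y s, v⁆⁆ + ∑ s, ⁅x s, ⁅⁅z, y s⁆, v⁆⁆ = 0 := by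
    simp only [h1, h2]
    rw [Finset.sum_comm, ← Finset.sum_add_distrib]
    refine Finset.sum_eq_zero fun r _ => ?_
    rw [← Finset.sum_add_distrib]
    refine Finset.sum_eq_zero fun s _ => ?_
    rw [← add_smul]
    have : killingForm ℂ L (y r) ⁅z, x s⁆ + killingForm ℂ L (x s) ⁅z, y r⁆ = 0 := by
      have h4 : killingForm ℂ L (y r) ⁅z, x s⁆ = killingForm ℂ L ⁅y r, z⁆ (x s) :=
        (LieModule.traceForm_apply_lie_apply ℂ L L _ _ _).symm
      rw [killingForm_comm (x s), h4, ← lie_skew z (y r), map_neg, LinearMap.neg_apply,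
        add_neg_cancel]
    rw [this, zero_smul]
  rw [lie_sum, ← sub_eq_zero, ← Finset.sum_sub_distrib, ← h3, ← Finset.sum_add_distrib]
  refine Finset.sum_congr rfl fun s _ => ?_
  rw [leibniz_lie z (x s), leibniz_lie z (y s), lie_add]
  abel

end Casimir

end

/-! ### From the Casimir operator to a Laplace equation for the character -/

section

variable {b : (rootSystem H).Base}

section Trace

variable (V : Type*) [AddCommGroup V] [Module ℂ V] [LieRingModule L V] [LieModule ℂ L V]
  [FiniteDimensional ℂ V]

theorem mem_weightSpace_iff {V : Type*} [AddCommGroup V] [Module ℂ V] [LieRingModule L V]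
    [LieModule ℂ L V] {μ : Dual ℂ H} {v : V} :
    v ∈ LieModule.weightSpace V (μ : H → ℂ) ↔ ∀ h : H, ⁅(h : L), v⁆ = μ h • v :=
  LieModule.mem_weightSpace _ _

theorem lie_mem_weightSpace_of_mem {V : Type*} [AddCommGroup V] [Module ℂ V] [LieRingModule L V]
    [LieModule ℂ L V] {α μ ν : Dual ℂ H} {x : L} {v : V}
    (hx : x ∈ LieAlgebra.rootSpace H (α : H → ℂ))
    (hv : v ∈ LieModule.weightSpace V (μ : H → ℂ)) (h : α + μ = ν) :
    ⁅x, v⁆ ∈ LieModule.weightSpace V (ν : H → ℂ) := by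
  rw [mem_weightSpace_iff] at hv ⊢
  intro z
  have h1 : ⁅(z : L), x⁆ = α z • x := lie_eq_smul_of_mem_rootSpace hx z
  rw [leibniz_lie, h1, hv, smul_lie, lie_smul, ← add_smul, ← h, LinearMap.add_apply]

/-- The action of a root vector between weight spaces. -/
def rootMap {α : Dual ℂ H} {x : L} (hx : x ∈ LieAlgebra.rootSpace H (α : H → ℂ)) (μ ν : Dual ℂ H)
    (h : α + μ = ν) :
    LieModule.weightSpace V (μ : H → ℂ) →ₗ[ℂ] LieModule.weightSpace V (ν : H → ℂ) :=
  (LieModule.toEnd ℂ L V x).restrict fun _ hv => lie_mem_weightSpace_of_mem hx hv h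

theorem coe_rootMap {α : Dual ℂ H} {x : L} (hx : x ∈ LieAlgebra.rootSpace H (α : H → ℂ))
    (μ ν : Dual ℂ H) (h : α + μ = ν) (v : LieModule.weightSpace V (μ : H → ℂ)) :
    (rootMap V hx μ ν h v : V) = ⁅x, (v : V)⁆ := rfl

/-- The trace of `e_α f_α` on the weight space of weight `μ`. -/
def weightTrace (i : H.root) (μ : Dual ℂ H) : ℂ :=
  LinearMap.trace ℂ (LieModule.weightSpace V (μ : H → ℂ))
    (rootMap V (rootE_mem i) (μ - (rootSystem H).root i) μ (add_sub_cancel _ _) ∘ₗ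
      rootMap V (α := -(rootSystem H).root i) (rootF_mem i) μ (μ - (rootSystem H).root i)
        (neg_add_eq_sub _ _))

/-- This is tr(AB) = tr(BA) for maps between two weight spaces. -/
theorem weightTrace_add (i : H.root) (μ : Dual ℂ H) :
    weightTrace V i (μ + (rootSystem H).root i) =
      LinearMap.trace ℂ (LieModule.weightSpace V (μ : H → ℂ))
        (rootMap V (α := -(rootSystem H).root i) (rootF_mem i) (μ + (rootSystem H).root i) μ
            (by abel) ∘ₗ
          rootMap V (rootE_mem i) μ (μ + (rootSystem H).root i) (add_comm _ _)) := by
  -- The weight μ + α - α is only propositionally μ, so it is replaced by a variable ν that can be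
  -- substituted away.
  have key : ∀ ν (h : ν = μ), weightTrace V i (μ + (rootSystem H).root i) =
      weightTrace V i (μ + (rootSystem H).root i) →
      LinearMap.trace ℂ (LieModule.weightSpace V ((μ + (rootSystem H).root i : Dual ℂ H) : H → ℂ))
        (rootMap V (rootE_mem i) ν (μ + (rootSystem H).root i) (by rw [h, add_comm]) ∘ₗ
          rootMap V (α := -(rootSystem H).root i) (rootF_mem i) (μ + (rootSystem H).root i) ν
            (by rw [h]; abel)) =
      LinearMap.trace ℂ (LieModule.weightSpace V (μ : H → ℂ))
        (rootMap V (α := -(rootSystem H).root i) (rootF_mem i) (μ + (rootSystem H).root i) μ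
            (by abel) ∘ₗ
          rootMap V (rootE_mem i) μ (μ + (rootSystem H).root i) (add_comm _ _)) := by
    rintro ν rfl -
    exact LinearMap.trace_comp_comm' _ _
  exact key _ (add_sub_cancel_right _ _) rfl

/-- The difference is the trace of [e_α, f_α], the Cartan element dual to α, which acts on the
μ-weight space by the scalar (α, μ). -/
theorem weightTrace_sub (i : H.root) (μ : Dual ℂ H) :
    weightTrace V i μ - weightTrace V i (μ + (rootSystem H).root i) =
      dualForm H ((rootSystem H).root i) μ * weightMult V μ := by
  rw [weightTrace_add, weightTrace, ← map_sub, weightMult, ← LinearMap.trace_one, ← smul_eq_mul,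
    ← map_smul]
  congr 1
  ext v
  simp only [LinearMap.sub_apply, LinearMap.comp_apply, LinearMap.smul_apply, Module.End.one_apply,
    LieSubmodule.coe_sub, LieSubmodule.coe_smul, coe_rootMap]
  rw [← lie_lie, lie_rootE_rootF, dualForm_comm]
  exact mem_weightSpace_iff.mp v.2 _

/-- The Casimir operator on a representation. -/
def casimirOp (b : (rootSystem H).Base) (v : V) : V :=
  ∑ s, ⁅casimirFst H b s, ⁅casimirSnd H b s, v⁆⁆

theorem dualForm_eq_sum_basis (μ ν : Dual ℂ H) :
    dualForm H μ ν = ∑ k, μ (finBasis ℂ H k) *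
      ν ((cartanEquivDual H).symm ((finBasis ℂ H).coord k)) := by
  rw [dualForm_comm, dualForm_apply]
  conv_lhs => rw [← (finBasis ℂ H).sum_dual_apply_smul_coord μ]
  simp only [map_sum, map_smul, smul_eq_mul]

theorem casimirOp_of_mem_weightSpace {μ : Dual ℂ H} {v : V}
    (hv : v ∈ LieModule.weightSpace V (μ : H → ℂ)) :
    casimirOp V b v = dualForm H μ μ • v + ∑ i ∈ posRoots b,
      (⁅rootE i, ⁅rootF i, v⁆⁆ + ⁅rootF i, ⁅rootE i, v⁆⁆) := by
  rw [mem_weightSpace_iff] at hv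
  simp only [casimirOp, Fintype.sum_sum_type, casimirFst, casimirSnd, Sum.elim_inl, Sum.elim_inr,
    hv, lie_smul, smul_smul]
  rw [← Finset.sum_smul, dualForm_eq_sum_basis, ← Finset.sum_add_distrib,
    Finset.sum_coe_sort (posRoots b) fun i => ⁅rootE i, ⁅rootF i, v⁆⁆ + ⁅rootF i, ⁅rootE i, v⁆⁆]
  simp only [mul_comm]

theorem casimir_trace {c : ℂ} (hc : ∀ v : V, casimirOp V b v = c • v) (μ : Dual ℂ H) :
    c * weightMult V μ = dualForm H μ μ * weightMult V μ +
      ∑ i ∈ posRoots b, (weightTrace V i μ + weightTrace V i (μ + (rootSystem H).root i)) := by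
  simp only [weightTrace_add]
  simp only [weightTrace, ← map_add, ← map_sum]
  rw [weightMult, ← LinearMap.trace_one, ← smul_eq_mul, ← map_smul, ← smul_eq_mul, ← map_smul,
    ← map_add]
  congr 1
  ext v
  have h := casimirOp_of_mem_weightSpace (b := b) V v.2
  rw [hc] at h
  simp only [LinearMap.add_apply, LinearMap.smul_apply, Module.End.one_apply, LinearMap.sum_apply,
    LinearMap.comp_apply, LieSubmodule.coe_add, LieSubmodule.coe_smul]
  rw [h]
  congr 1
  refine Eq.trans ?_ (map_sum (LieModule.weightSpace V (μ : H → ℂ)).toSubmodule.subtype _ _).symm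
  rfl

end Trace

section Laplacian

/-- The linear operator on the group ring multiplying the coefficient of `e_ν` by `g ν`. -/
def diagOp (g : Dual ℂ H → ℂ) (x : AddMonoidAlgebra ℂ (Dual ℂ H)) :
    AddMonoidAlgebra ℂ (Dual ℂ H) :=
  .ofCoeff (Finsupp.onFinset x.coeff.support (fun ν => g ν * x.coeff ν) fun ν hν => by
    rw [Finsupp.mem_support_iff]
    exact right_ne_zero_of_mul hν)

theorem coeff_diagOp (g : Dual ℂ H → ℂ) (x : AddMonoidAlgebra ℂ (Dual ℂ H)) (ν : Dual ℂ H) :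
    (diagOp g x).coeff ν = g ν * x.coeff ν := rfl

theorem diagOp_add (g : Dual ℂ H → ℂ) (x y : AddMonoidAlgebra ℂ (Dual ℂ H)) :
    diagOp g (x + y) = diagOp g x + diagOp g y := by
  ext ν
  simp [coeff_diagOp, mul_add]

theorem diagOp_zero (g : Dual ℂ H → ℂ) : diagOp g 0 = 0 := by
  ext ν
  simp [coeff_diagOp]

theorem diagOp_single (g : Dual ℂ H → ℂ) (μ : Dual ℂ H) (r : ℂ) :
    diagOp g (AddMonoidAlgebra.single μ r) = AddMonoidAlgebra.single μ (g μ * r) := by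
  classical
  ext ν
  simp only [coeff_diagOp, AddMonoidAlgebra.coeff_single, Finsupp.single_apply]
  split_ifs with h
  · rw [h]
  · rw [mul_zero]

variable (H) in
/-- The Laplace operator `e_ν ↦ (ν, ν) e_ν`. -/
abbrev laplace : AddMonoidAlgebra ℂ (Dual ℂ H) → AddMonoidAlgebra ℂ (Dual ℂ H) :=
  diagOp fun ν => dualForm H ν ν

/-- The derivation `e_ν ↦ (μ, ν) e_ν`. -/
abbrev gradOp (μ : Dual ℂ H) : AddMonoidAlgebra ℂ (Dual ℂ H) → AddMonoidAlgebra ℂ (Dual ℂ H) :=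
  diagOp fun ν => dualForm H μ ν

/-- The failure of the Laplace operator to be a derivation. -/
def carre (x y : AddMonoidAlgebra ℂ (Dual ℂ H)) : AddMonoidAlgebra ℂ (Dual ℂ H) :=
  laplace H (x * y) - laplace H x * y - x * laplace H y

theorem carre_add_left (x y z : AddMonoidAlgebra ℂ (Dual ℂ H)) :
    carre (x + y) z = carre x z + carre y z := by
  simp only [carre, add_mul, diagOp_add]
  abel

theorem carre_add_right (x y z : AddMonoidAlgebra ℂ (Dual ℂ H)) :
    carre x (y + z) = carre x y + carre x z := by
  simp only [carre, mul_add, diagOp_add]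
  abel

theorem carre_zero_left (x : AddMonoidAlgebra ℂ (Dual ℂ H)) : carre 0 x = 0 := by
  simp [carre, diagOp_zero]

theorem carre_zero_right (x : AddMonoidAlgebra ℂ (Dual ℂ H)) : carre x 0 = 0 := by
  simp [carre, diagOp_zero]

theorem carre_one_left (x : AddMonoidAlgebra ℂ (Dual ℂ H)) : carre 1 x = 0 := by
  have h : laplace H 1 = 0 := by
    rw [laplace, AddMonoidAlgebra.one_def, diagOp_single, map_zero, zero_mul,
      AddMonoidAlgebra.single_zero]
  rw [carre, h, one_mul, one_mul, zero_mul, sub_zero, sub_self]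

theorem carre_single_left (μ : Dual ℂ H) (x : AddMonoidAlgebra ℂ (Dual ℂ H)) :
    carre (AddMonoidAlgebra.single μ 1) x =
      2 * AddMonoidAlgebra.single μ 1 * gradOp μ x := by
  induction x using AddMonoidAlgebra.induction_linear with
  | zero => simp only [gradOp, carre_zero_right, diagOp_zero, mul_zero]
  | add x y hx hy => rw [carre_add_right, hx, hy, gradOp, diagOp_add, mul_add]
  | single ν r =>
    rw [mul_assoc, two_mul]
    simp only [carre, diagOp_single, AddMonoidAlgebra.single_mul_single,
      ← AddMonoidAlgebra.single_add, ← AddMonoidAlgebra.single_sub]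
    congr 1
    simp only [map_add, LinearMap.add_apply]
    rw [dualForm_comm ν μ]
    ring

/-- On exponentials `carre` is 2(μ,ν) e_{μ+ν}; bilinearity of the form makes it a derivation in each
argument. -/
theorem carre_mul_left (x y z : AddMonoidAlgebra ℂ (Dual ℂ H)) :
    carre (x * y) z = x * carre y z + y * carre x z := by
  induction x using AddMonoidAlgebra.induction_linear with
  | zero => simp [carre_zero_left]
  | add x x' hx hx' => rw [add_mul, carre_add_left, hx, hx', carre_add_left]; ring
  | single μ r =>
  induction y using AddMonoidAlgebra.induction_linear with
  | zero => simp [carre_zero_left]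
  | add y y' hx hx' => rw [mul_add, carre_add_left, hx, hx', carre_add_left]; ring
  | single ν s =>
  induction z using AddMonoidAlgebra.induction_linear with
  | zero => simp [carre_zero_right]
  | add z z' hx hx' => simp only [carre_add_right, hx, hx']; ring
  | single κ t =>
    simp only [carre, diagOp_single, AddMonoidAlgebra.single_mul_single,
      ← AddMonoidAlgebra.single_sub]
    rw [show ν + (μ + κ) = μ + ν + κ by abel, ← add_assoc, ← AddMonoidAlgebra.single_add]
    congr 1
    simp only [map_add, LinearMap.add_apply]
    rw [dualForm_comm ν μ, dualForm_comm κ μ, dualForm_comm κ ν]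
    ring

/-- All exponents lie in one Weyl orbit, hence have the norm of ρ. -/
theorem laplace_weylDenominator :
    laplace H (weylDenominator b) =
      AddMonoidAlgebra.single 0 (dualForm H (rho b) (rho b)) * weylDenominator b := by
  ext ν
  rw [coeff_diagOp, coeff_single_mul_sub, sub_zero]
  by_cases h : (weylDenominator b).coeff ν = 0
  · rw [h, mul_zero, mul_zero]
  · obtain ⟨σ, rfl⟩ := exists_smul_rho_of_coeff_weylDenominator_ne_zero h
    rw [dualForm_smul_smul]

theorem two_gradOp_rho (x : AddMonoidAlgebra ℂ (Dual ℂ H)) :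
    2 * gradOp (rho b) x = ∑ i ∈ posRoots b, gradOp ((rootSystem H).root i) x := by
  ext ν
  rw [AddMonoidAlgebra.coeff_sum, Finsupp.finsetSum_apply, two_mul, AddMonoidAlgebra.coeff_add,
    Finsupp.add_apply]
  simp only [coeff_diagOp, rho, posRoots]
  rw [← Finset.sum_mul, map_smul, map_sum, LinearMap.smul_apply, LinearMap.sum_apply]
  simp only [smul_eq_mul]
  ring

end Laplacian

section CharacterEquation

variable (V : Type*) [AddCommGroup V] [Module ℂ V] [LieRingModule L V] [LieModule ℂ L V]
  [FiniteDimensional ℂ V]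

variable (H) in
/-- The inclusion of the integral group ring into the complex group ring. -/
def toComplex : AddMonoidAlgebra ℤ (Dual ℂ H) →+* AddMonoidAlgebra ℂ (Dual ℂ H) :=
  AddMonoidAlgebra.mapRingHom (Dual ℂ H) (Int.castRingHom ℂ)

theorem coeff_toComplex (x : AddMonoidAlgebra ℤ (Dual ℂ H)) (ν : Dual ℂ H) :
    (toComplex H x).coeff ν = x.coeff ν := by
  simp [toComplex]

theorem coeff_formalCharacter (ν : Dual ℂ H) :
    (formalCharacter H V).coeff ν = (weightMult V ν : ℤ) := rfl

theorem weightTrace_eq_zero {i : H.root} {μ : Dual ℂ H} (h : weightMult V μ = 0) :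
    weightTrace V i μ = 0 := by
  have : Subsingleton (LieModule.weightSpace V (μ : H → ℂ)) :=
    Module.finrank_zero_iff.mp h
  rw [weightTrace, Subsingleton.elim (rootMap V (rootE_mem i) _ μ _ ∘ₗ _) 0, map_zero]

/-- The generating function of the traces of `e_α f_α` on weight spaces. -/
def traceSeries (i : H.root) : AddMonoidAlgebra ℂ (Dual ℂ H) :=
  .ofCoeff (Finsupp.onFinset (formalCharacter H V).coeff.support (weightTrace V i) fun μ hμ => by
    rw [Finsupp.mem_support_iff, coeff_formalCharacter, Nat.cast_ne_zero]
    exact fun h => hμ (weightTrace_eq_zero V h))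

theorem coeff_traceSeries (i : H.root) (μ : Dual ℂ H) :
    (traceSeries V i).coeff μ = weightTrace V i μ := rfl

theorem one_sub_mul_traceSeries (i : H.root) :
    (1 - AddMonoidAlgebra.single (-(rootSystem H).root i) 1) * traceSeries V i =
      gradOp ((rootSystem H).root i) (toComplex H (formalCharacter H V)) := by
  ext μ
  rw [sub_mul_coeff_apply, coeff_traceSeries, coeff_traceSeries, weightTrace_sub, coeff_diagOp,
    coeff_toComplex, coeff_formalCharacter, Int.cast_natCast]

theorem casimir_series {c : ℂ} (hc : ∀ v : V, casimirOp V b v = c • v) :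
    AddMonoidAlgebra.single 0 c * toComplex H (formalCharacter H V) =
      laplace H (toComplex H (formalCharacter H V)) + ∑ i ∈ posRoots b,
        (1 + AddMonoidAlgebra.single (-(rootSystem H).root i) 1) * traceSeries V i := by
  ext μ
  rw [AddMonoidAlgebra.coeff_add, Finsupp.add_apply, AddMonoidAlgebra.coeff_sum,
    Finsupp.finsetSum_apply, coeff_diagOp, coeff_single_mul_sub, sub_zero]
  simp only [add_mul, one_mul, AddMonoidAlgebra.coeff_add, Finsupp.add_apply, coeff_single_mul_sub,
    coeff_traceSeries, sub_neg_eq_add, coeff_toComplex, coeff_formalCharacter, Int.cast_natCast]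
  exact casimir_trace V hc μ

/-- With T_α = `traceSeries`, the factor 1 - e_{-α} contributes 2 e_{-α} ∂_α ch, and
`one_sub_mul_traceSeries` rewrites ∂_α ch as (1 - e_{-α}) T_α. The differentiated factor thus
reappears, and the product comes out whole without any division. -/
theorem carre_prod (s : Finset H.root) :
    carre (∏ i ∈ s, (1 - AddMonoidAlgebra.single (-(rootSystem H).root i) (1 : ℂ)))
      (toComplex H (formalCharacter H V)) =
    (∏ i ∈ s, (1 - AddMonoidAlgebra.single (-(rootSystem H).root i) (1 : ℂ))) *
      ∑ i ∈ s, 2 * AddMonoidAlgebra.single (-(rootSystem H).root i) 1 * traceSeries V i := by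
  classical
  induction s using Finset.induction_on with
  | empty => simp [carre_one_left]
  | insert i s hi ih =>
    have h : carre (1 - AddMonoidAlgebra.single (-(rootSystem H).root i) (1 : ℂ))
        (toComplex H (formalCharacter H V)) =
        (1 - AddMonoidAlgebra.single (-(rootSystem H).root i) (1 : ℂ)) *
        (2 * AddMonoidAlgebra.single (-(rootSystem H).root i) 1 * traceSeries V i) := by
      have h1 := carre_add_left (1 - AddMonoidAlgebra.single (-(rootSystem H).root i) (1 : ℂ))
        (AddMonoidAlgebra.single (-(rootSystem H).root i) (1 : ℂ))
        (toComplex H (formalCharacter H V))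
      rw [sub_add_cancel, carre_one_left, carre_single_left] at h1
      have h2 : gradOp (-(rootSystem H).root i) (toComplex H (formalCharacter H V)) =
          -gradOp ((rootSystem H).root i) (toComplex H (formalCharacter H V)) := by
        ext ν
        simp [coeff_diagOp]
      rw [h2, ← one_sub_mul_traceSeries] at h1
      linear_combination -h1
    rw [Finset.prod_insert hi, carre_mul_left, ih, h, Finset.sum_insert hi]
    ring

/-- In Δ(D·ch) = Δ(D)·ch + D·Δ(ch) + `carre` D ch the last term is D times the very sum by which
Δ(ch) differs from c·ch in `casimir_series`, so both disappear. -/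
theorem laplace_weylDenominator_mul {c : ℂ} (hc : ∀ v : V, casimirOp V b v = c • v) :
    laplace H (weylDenominator b * toComplex H (formalCharacter H V)) =
      AddMonoidAlgebra.single 0 (dualForm H (rho b) (rho b) + c) *
        (weylDenominator b * toComplex H (formalCharacter H V)) := by
  have h1 : carre (weylDenominator b) (toComplex H (formalCharacter H V)) =
      weylDenominator b * ∑ i ∈ posRoots b,
        (1 + AddMonoidAlgebra.single (-(rootSystem H).root i) 1) * traceSeries V i := by
    rw [weylDenominator, carre_mul_left, carre_prod, carre_single_left]
    -- Here 1 + e_{-α} = 2e_{-α} + (1 - e_{-α}); the second summand turns T_α into ∂_α ch, and the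
    -- sum of these over positive roots is 2∂_ρ ch.
    have h2 : ∑ i ∈ posRoots b,
        (1 + AddMonoidAlgebra.single (-(rootSystem H).root i) 1) * traceSeries V i =
        (∑ i ∈ posRoots b, 2 * AddMonoidAlgebra.single (-(rootSystem H).root i) 1 *
          traceSeries V i) + 2 * gradOp (rho b) (toComplex H (formalCharacter H V)) := by
      rw [two_gradOp_rho, ← Finset.sum_add_distrib]
      refine Finset.sum_congr rfl fun i _ => ?_
      rw [← one_sub_mul_traceSeries]
      ring
    rw [h2]
    ring
  have h3 := casimir_series V hc
  have h4 := laplace_weylDenominator (b := b)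
  rw [AddMonoidAlgebra.single_add]
  rw [carre, h4] at h1
  linear_combination h1 - weylDenominator b * h3

end CharacterEquation

end

/-! ### Highest weight modules and the Weyl character formula at dominant weights -/

section

variable {b : (rootSystem H).Base}

open scoped ComplexOrder

section HighestWeight

variable {V : Type*} [AddCommGroup V] [Module ℂ V] [LieRingModule L V] [LieModule ℂ L V]

/-- `v` has weight `lam` and is annihilated by all positive root spaces. -/
def IsHighestWeightVector (b : (rootSystem H).Base) (lam : Dual ℂ H) (v : V) : Prop :=
  (∀ h : H, ⁅h, v⁆ = lam h • v) ∧ ∀ i : H.root, b.IsPos i →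
    ∀ x ∈ LieAlgebra.rootSpace H ((rootSystem H).root i : H → ℂ), ⁅x, v⁆ = 0

/-- The smallest subspace containing `v` and stable under negative root vectors. -/
def lowSpan (b : (rootSystem H).Base) (v : V) : Submodule ℂ V :=
  sInf {N | v ∈ N ∧ ∀ i, b.IsPos i → ∀ x ∈ N, ⁅rootF i, x⁆ ∈ N}

theorem lowSpan_le {v : V} {N : Submodule ℂ V} (hv : v ∈ N)
    (hN : ∀ i, b.IsPos i → ∀ x ∈ N, ⁅rootF i, x⁆ ∈ N) : lowSpan b v ≤ N :=
  sInf_le ⟨hv, hN⟩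

theorem mem_lowSpan_self (v : V) : v ∈ lowSpan b v :=
  Submodule.mem_sInf.mpr fun _ hN => hN.1

theorem rootF_lie_mem_lowSpan {v w : V} {i : H.root} (hi : b.IsPos i) (hw : w ∈ lowSpan b v) :
    ⁅rootF i, w⁆ ∈ lowSpan b v :=
  Submodule.mem_sInf.mpr fun _ hN => hN.2 i hi _ (Submodule.mem_sInf.mp hw _ hN)

theorem lie_mem_lowSpan {lam : Dual ℂ H} {v : V} (hv : IsHighestWeightVector b lam v) {w : V}
    (hw : w ∈ lowSpan b v) (x : L) : ⁅x, w⁆ ∈ lowSpan b v := by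
  -- The vectors that all of L sends into the span. T contains v and is stable under each f_i, since
  -- x f_i w = [x, f_i] w + f_i x w; minimality of the span then replaces any ordering of monomials.
  let T : Submodule ℂ V :=
    { carrier := {w | w ∈ lowSpan b v ∧ ∀ x : L, ⁅x, w⁆ ∈ lowSpan b v}
      add_mem' := fun {y z} hy hz => ⟨add_mem hy.1 hz.1, fun x => by
        rw [lie_add]; exact add_mem (hy.2 x) (hz.2 x)⟩
      zero_mem' := ⟨zero_mem _, fun x => by rw [lie_zero]; exact zero_mem _⟩
      smul_mem' := fun c y hy => ⟨Submodule.smul_mem _ c hy.1, fun x => by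
        rw [lie_smul]; exact Submodule.smul_mem _ c (hy.2 x)⟩ }
  have hT : lowSpan b v ≤ T := by
    refine lowSpan_le ⟨mem_lowSpan_self v, fun x => ?_⟩ fun i hi w hw =>
      ⟨rootF_lie_mem_lowSpan hi hw.1, fun x => ?_⟩
    · induction x using cartan_root_induction (H := H) with
      | cartan h =>
        have h1 : ⁅(h : L), v⁆ = lam h • v := hv.1 h
        rw [h1]
        exact Submodule.smul_mem _ _ (mem_lowSpan_self v)
      | root i x hx =>
        rcases isPos_or_exists_neg (b := b) i with hi | ⟨j, hj, hij⟩
        · rw [hv.2 i hi x hx]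
          exact zero_mem _
        · have hF : rootF j ∈ LieAlgebra.rootSpace H ((rootSystem H).root i : H → ℂ) := by
            rw [hij]; exact rootF_mem j
          obtain ⟨c, rfl⟩ := eq_smul_of_mem_rootSpace hF (rootF_ne_zero j) hx
          rw [smul_lie]
          exact Submodule.smul_mem _ _ (rootF_lie_mem_lowSpan hj (mem_lowSpan_self v))
      | add x y hx hy => rw [add_lie]; exact add_mem hx hy
    · rw [leibniz_lie]
      exact add_mem (hw.2 _) (rootF_lie_mem_lowSpan hi (hw.2 x))
  exact (hT hw).2 x

/-- The submodule generated by a highest weight vector. -/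
def lowSubmodule {lam : Dual ℂ H} {v : V} (hv : IsHighestWeightVector b lam v) :
    LieSubmodule ℂ L V where
  __ := lowSpan b v
  lie_mem := fun hw => lie_mem_lowSpan hv hw _

variable (V) in
theorem iSupIndep_weightSpace :
    iSupIndep fun ν : Dual ℂ H => (LieModule.weightSpace V (ν : H → ℂ)).toSubmodule := by
  have h := LieSubmodule.iSupIndep_toSubmodule.mpr (LieModule.iSupIndep_genWeightSpace ℂ H V)
  exact (h.comp (f := fun ν : Dual ℂ H => (ν : H → ℂ)) DFunLike.coe_injective).mono
    fun ν => LieModule.weightSpace_le_genWeightSpace V _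

/-- Keeping the line of v apart from the strictly lower weights yields at once the bound on the
weights and the multiplicity one of `lam`, by independence of weight spaces. -/
theorem lowSpan_le_weights {lam : Dual ℂ H} {v : V} (hv : IsHighestWeightVector b lam v) :
    lowSpan b v ≤ Submodule.span ℂ {v} ⊔ ⨆ ν : {ν : Dual ℂ H // lam - ν ∈ posCone b ∧ ν ≠ lam},
      (LieModule.weightSpace V (ν : H → ℂ)).toSubmodule := by
  refine lowSpan_le (Submodule.mem_sup_left (Submodule.mem_span_singleton_self v)) ?_
  intro i hi
  have hα := root_mem_posCone b hi
  have hF : ∀ {μ : Dual ℂ H} {x : V}, lam - μ ∈ posCone b →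
      x ∈ LieModule.weightSpace V (μ : H → ℂ) →
      ⁅rootF i, x⁆ ∈ ⨆ ν : {ν : Dual ℂ H // lam - ν ∈ posCone b ∧ ν ≠ lam},
      (LieModule.weightSpace V (ν : H → ℂ)).toSubmodule := by
    intro μ x hμ hx
    have hmem : lam - (μ - (rootSystem H).root i) ∈ posCone b := by
      have := add_mem hμ hα
      rwa [show lam - μ + (rootSystem H).root i = lam - (μ - (rootSystem H).root i) by abel] at this
    refine Submodule.mem_iSup_of_mem ⟨μ - (rootSystem H).root i, hmem, ?_⟩
      (lie_mem_weightSpace_of_mem (α := -(rootSystem H).root i) (rootF_mem i) hx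
        (neg_add_eq_sub _ _))
    intro h
    refine (rootSystem H).ne_zero i (eq_zero_of_mem_posCone_of_neg_mem b hα ?_)
    rw [← h] at hμ
    rwa [show μ - (rootSystem H).root i - μ = -(rootSystem H).root i by abel] at hμ
  generalize hN : Submodule.span ℂ {v} ⊔ (⨆ ν : {ν : Dual ℂ H // lam - ν ∈ posCone b ∧ ν ≠ lam},
      (LieModule.weightSpace V (ν : H → ℂ)).toSubmodule) = N
  suffices N ≤ N.comap (LieModule.toEnd ℂ L V (rootF i)) from fun x hx => this hx
  rw [← hN]
  refine sup_le ?_ (iSup_le fun ν => ?_)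
  · rw [Submodule.span_singleton_le_iff_mem]
    exact Submodule.mem_sup_right (hF (by simp) (mem_weightSpace_iff.mpr hv.1))
  · exact fun x hx => Submodule.mem_sup_right (hF ν.2.1 hx)

theorem iSup_lower_le_iSup_ne (lam κ : Dual ℂ H) (hκ : lam - κ ∈ posCone b → κ = lam) :
    (⨆ ν : {ν : Dual ℂ H // lam - ν ∈ posCone b ∧ ν ≠ lam},
      (LieModule.weightSpace V (ν : H → ℂ)).toSubmodule) ≤
    ⨆ (ν : Dual ℂ H) (_ : ν ≠ κ), (LieModule.weightSpace V (ν : H → ℂ)).toSubmodule :=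
  iSup_le fun ν => le_iSup₂_of_le (f := fun (ν : Dual ℂ H) (_ : ν ≠ κ) =>
    (LieModule.weightSpace V (ν : H → ℂ)).toSubmodule) ν.1
      (fun h => ν.2.2 (h.trans (hκ (h ▸ ν.2.1)))) le_rfl

theorem sub_mem_posCone_of_mem_lowSpan {lam : Dual ℂ H} {v : V}
    (hv : IsHighestWeightVector b lam v) {ν : Dual ℂ H} {w : V} (hw : w ∈ lowSpan b v)
    (hν : w ∈ LieModule.weightSpace V (ν : H → ℂ)) (h0 : w ≠ 0) : lam - ν ∈ posCone b := by
  by_contra hc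
  have hle : Submodule.span ℂ {v} ⊔ (⨆ ν : {ν : Dual ℂ H // lam - ν ∈ posCone b ∧ ν ≠ lam},
      (LieModule.weightSpace V (ν : H → ℂ)).toSubmodule) ≤
      ⨆ (κ : Dual ℂ H) (_ : κ ≠ ν), (LieModule.weightSpace V (κ : H → ℂ)).toSubmodule := by
    refine sup_le ?_ (iSup_lower_le_iSup_ne lam ν fun h => absurd h hc)
    rw [Submodule.span_singleton_le_iff_mem]
    refine Submodule.mem_iSup_of_mem lam (Submodule.mem_iSup_of_mem ?_
      (mem_weightSpace_iff.mpr hv.1))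
    rintro rfl
    simp at hc
  exact h0 (Submodule.disjoint_def.mp (iSupIndep_weightSpace V ν) w hν
    (hle (lowSpan_le_weights hv hw)))

theorem mem_span_of_mem_lowSpan {lam : Dual ℂ H} {v : V} (hv : IsHighestWeightVector b lam v)
    {w : V} (hw : w ∈ lowSpan b v) (hν : w ∈ LieModule.weightSpace V (lam : H → ℂ)) :
    w ∈ Submodule.span ℂ {v} := by
  obtain ⟨y, hy, z, hz, rfl⟩ := Submodule.mem_sup.mp (lowSpan_le_weights hv hw)
  have hy' : y ∈ LieModule.weightSpace V (lam : H → ℂ) := by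
    obtain ⟨c, rfl⟩ := Submodule.mem_span_singleton.mp hy
    exact Submodule.smul_mem (LieModule.weightSpace V (lam : H → ℂ)).toSubmodule c
      (mem_weightSpace_iff.mpr hv.1)
  have hz' : z ∈ LieModule.weightSpace V (lam : H → ℂ) := by
    have := sub_mem hν hy'
    rwa [add_sub_cancel_left] at this
  have hz0 : z = 0 := Submodule.disjoint_def.mp (iSupIndep_weightSpace V lam) z hz'
    (iSup_lower_le_iSup_ne lam lam (fun _ => rfl) hz)
  rwa [hz0, add_zero]

end HighestWeight

section Irreducible

variable {V : Type*} [AddCommGroup V] [Module ℂ V] [LieRingModule L V] [LieModule ℂ L V]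

theorem lowSpan_eq_top [LieModule.IsIrreducible ℂ L V] {lam : Dual ℂ H} {v : V} (h0 : v ≠ 0)
    (hv : IsHighestWeightVector b lam v) : lowSpan b v = ⊤ := by
  have h : lowSubmodule hv = ⊤ := (eq_bot_or_eq_top _).resolve_left fun h => h0 (by
    have h1 : v ∈ lowSubmodule hv := mem_lowSpan_self (b := b) v
    rwa [h, LieSubmodule.mem_bot] at h1)
  have h2 := congrArg LieSubmodule.toSubmodule h
  simpa [lowSubmodule] using h2

theorem weightMult_ne_zero_iff [FiniteDimensional ℂ V] {ν : Dual ℂ H} :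
    weightMult V ν ≠ 0 ↔ ∃ v : V, v ≠ 0 ∧ ∀ h : H, ⁅h, v⁆ = ν h • v := by
  rw [weightMult, ← Nat.pos_iff_ne_zero, Module.finrank_pos_iff_exists_ne_zero]
  constructor
  · rintro ⟨⟨v, hv⟩, h0⟩
    exact ⟨v, fun h => h0 (Subtype.ext h), (LieModule.mem_weightSpace _ _).mp hv⟩
  · rintro ⟨v, h0, hv⟩
    exact ⟨⟨v, (LieModule.mem_weightSpace _ _).mpr hv⟩, fun h => h0 (congrArg Subtype.val h)⟩

variable [FiniteDimensional ℂ V] {lam : Dual ℂ H}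

theorem IsIrreducibleOfHighestWeight.sub_mem_posCone (hV : IsIrreducibleOfHighestWeight V b lam)
    {ν : Dual ℂ H} (hν : weightMult V ν ≠ 0) : lam - ν ∈ posCone b := by
  obtain ⟨-, hirr, v, h0, hv⟩ := hV
  obtain ⟨w, hw0, hw⟩ := weightMult_ne_zero_iff.mp hν
  refine sub_mem_posCone_of_mem_lowSpan (b := b) hv ?_ (mem_weightSpace_iff.mpr hw) hw0
  rw [lowSpan_eq_top h0 hv]
  trivial

theorem IsIrreducibleOfHighestWeight.weightMult_eq_one
    (hV : IsIrreducibleOfHighestWeight V b lam) : weightMult V lam = 1 := by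
  obtain ⟨-, hirr, v, h0, hv⟩ := hV
  refine (finrank_eq_one_iff_of_nonzero' (⟨v, mem_weightSpace_iff.mpr hv.1⟩ :
    LieModule.weightSpace V (lam : H → ℂ)) fun h => h0 (congrArg Subtype.val h)).mpr ?_
  rintro ⟨w, hw⟩
  have h1 : w ∈ lowSpan b v := by rw [lowSpan_eq_top h0 hv]; trivial
  obtain ⟨c, hc⟩ := Submodule.mem_span_singleton.mp (mem_span_of_mem_lowSpan hv h1 hw)
  exact ⟨c, Subtype.ext hc⟩

/-- Schur's lemma: an eigenspace of an operator commuting with L is a submodule. -/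
theorem exists_casimirOp_eq_smul [LieModule.IsIrreducible ℂ L V] (b : (rootSystem H).Base) :
    ∃ c : ℂ, ∀ v : V, casimirOp V b v = c • v := by
  let f : Module.End ℂ V := ∑ s, LieModule.toEnd ℂ L V (casimirFst H b s) *
    LieModule.toEnd ℂ L V (casimirSnd H b s)
  have hf : ∀ v, f v = casimirOp V b v := fun v => by
    simp [f, casimirOp, LinearMap.sum_apply]
  have : Nontrivial V := (LieSubmodule.nontrivial_iff ℂ L V).mp inferInstance
  obtain ⟨c, hc⟩ := Module.End.exists_eigenvalue f
  let N : LieSubmodule ℂ L V :=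
    { f.eigenspace c with
      lie_mem := fun {x v} hv => by
        have hv' : f v = c • v := Module.End.mem_eigenspace_iff.mp hv
        change ⁅x, v⁆ ∈ f.eigenspace c
        rw [Module.End.mem_eigenspace_iff, hf, casimirOp,
          ← lie_sum_lie_of_dual (sum_killingForm_casimir b)]
        change ⁅x, casimirOp V b v⁆ = _
        rw [← hf, hv', lie_smul] }
  have hN : N = ⊤ := by
    refine (eq_bot_or_eq_top N).resolve_left fun h => hc ?_
    have := congrArg LieSubmodule.toSubmodule h
    simpa [N] using this
  refine ⟨c, fun v => ?_⟩
  have hv : v ∈ N := by rw [hN]; trivial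
  rw [← hf]
  exact Module.End.mem_eigenspace_iff.mp hv

end Irreducible

theorem nonneg_apply_coroot_of_mem_dominantWeights {μ : Dual ℂ H} (hμ : μ ∈ dominantWeights b)
    {i : H.root} (hi : i ∈ b.support) : 0 ≤ μ ((rootSystem H).coroot i) := by
  obtain ⟨n, hn⟩ := hμ i hi
  rw [hn]
  exact Nat.cast_nonneg n

open Classical in
-- If μ ≠ λ also contributed, λ - μ would lie in the cone and λ+ρ, μ+ρ would have equal norm, so
-- (λ+μ+2ρ, λ-μ) = 0. But λ+μ+2ρ is strictly dominant, which makes this product positive.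
theorem coeff_weylDenominator_mul_character {V : Type*} [AddCommGroup V] [Module ℂ V]
    [LieRingModule L V] [LieModule ℂ L V] [FiniteDimensional ℂ V] {lam μ : Dual ℂ H}
    (hV : IsIrreducibleOfHighestWeight V b lam) (hlam : lam ∈ dominantWeights b)
    (hμ : μ ∈ dominantWeights b) :
    (weylDenominator b * toComplex H (formalCharacter H V)).coeff (μ + rho b) =
      if μ = lam then 1 else 0 := by
  have hirr := hV.2.1
  obtain ⟨c, hc⟩ := exists_casimirOp_eq_smul (V := V) b
  have hlap := laplace_weylDenominator_mul V hc
  have hcoeff := coeff_prod_one_sub_mul (posRoots b) (fun i => mem_posRoots.mp)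
    (x := toComplex H (formalCharacter H V)) (lam := lam)
    (by rw [coeff_toComplex, coeff_formalCharacter, hV.weightMult_eq_one]; simp)
    (fun ν hν => by
      rw [coeff_toComplex, coeff_formalCharacter]
      by_contra h
      exact hν (hV.sub_mem_posCone fun h0 => h (by simp [h0])))
  have hD : ∀ ν, (weylDenominator b * toComplex H (formalCharacter H V)).coeff (ν + rho b) =
      ((∏ i ∈ posRoots b, (1 - AddMonoidAlgebra.single (-(rootSystem H).root i) (1 : ℂ))) *
        toComplex H (formalCharacter H V)).coeff ν := fun ν => by
    rw [weylDenominator, mul_assoc, coeff_single_mul_sub, one_mul, add_sub_cancel_right]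
  have hnorm : ∀ ν, (weylDenominator b * toComplex H (formalCharacter H V)).coeff (ν + rho b) ≠ 0 →
      dualForm H (ν + rho b) (ν + rho b) = dualForm H (rho b) (rho b) + c := by
    intro ν hν
    have h := congrArg (fun x => x.coeff (ν + rho b)) hlap
    simp only [coeff_diagOp, coeff_single_mul_sub, sub_zero] at h
    exact mul_right_cancel₀ hν h
  have h1 : (weylDenominator b * toComplex H (formalCharacter H V)).coeff (lam + rho b) = 1 := by
    rw [hD]; exact hcoeff.1
  split_ifs with h
  · rw [h, h1]
  · by_contra hne
    have hcone : lam - μ ∈ posCone b := by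
      by_contra hc'
      exact hne ((hD μ).trans (hcoeff.2 μ hc'))
    have h2 := (hnorm lam (by rw [h1]; exact one_ne_zero)).trans (hnorm μ hne).symm
    have h3 : dualForm H (lam + μ + (2 : ℂ) • rho b) (lam - μ) = 0 := by
      simp only [map_add, map_sub, map_smul, LinearMap.add_apply, LinearMap.smul_apply,
        smul_eq_mul] at h2 ⊢
      rw [dualForm_comm lam (rho b), dualForm_comm μ (rho b)] at h2
      rw [dualForm_comm μ lam]
      linear_combination h2
    refine (dualForm_pos_of_mem_posCone hcone (sub_ne_zero.mpr (Ne.symm h)) fun i hi => ?_).ne' h3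
    have h4 := nonneg_apply_coroot_of_mem_dominantWeights hlam hi
    have h5 := nonneg_apply_coroot_of_mem_dominantWeights hμ hi
    rw [LinearMap.add_apply, LinearMap.smul_apply, rho_apply_coroot hi, LinearMap.add_apply]
    refine add_pos_of_nonneg_of_pos (add_nonneg h4 h5) ?_
    rw [smul_eq_mul, mul_one]
    exact two_pos

end

/-! ### Uniqueness of irreducible modules; weight modules, submodules and quotients -/

section

variable {b : (rootSystem H).Base}

section Equivariant

variable {V W : Type*} [AddCommGroup V] [Module ℂ V] [LieRingModule L V] [LieModule ℂ L V]
  [AddCommGroup W] [Module ℂ W] [LieRingModule L W] [LieModule ℂ L W]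

theorem map_mem_weightSpace {f : V →ₗ⁅ℂ,L⁆ W} {ν : Dual ℂ H} {v : V}
    (hv : v ∈ LieModule.weightSpace V (ν : H → ℂ)) :
    f v ∈ LieModule.weightSpace W (ν : H → ℂ) := by
  rw [mem_weightSpace_iff] at hv ⊢
  intro h
  rw [← LieModuleHom.map_lie, hv, map_smul]

theorem weightMult_congr (f : V →ₗ⁅ℂ,L⁆ W) (hf : Function.Bijective f) (ν : Dual ℂ H) :
    weightMult V ν = weightMult W ν := by
  let e : V ≃ₗ[ℂ] W := LinearEquiv.ofBijective (f : V →ₗ[ℂ] W) hf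
  have h : (LieModule.weightSpace V (ν : H → ℂ)).toSubmodule.map (e : V →ₗ[ℂ] W) =
      (LieModule.weightSpace W (ν : H → ℂ)).toSubmodule := by
    ext w
    constructor
    · rintro ⟨v, hv, rfl⟩
      exact map_mem_weightSpace (f := f) hv
    · intro hw
      obtain ⟨v, rfl⟩ := hf.2 w
      refine ⟨v, mem_weightSpace_iff.mpr fun h => hf.1 ?_, rfl⟩
      rw [LieModuleHom.map_lie, map_smul]
      exact mem_weightSpace_iff.mp hw h
  exact (e.finrank_map_eq _).symm.trans (congrArg (fun N : Submodule ℂ W => finrank ℂ N) h)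

theorem formalCharacter_congr [FiniteDimensional ℂ V] [FiniteDimensional ℂ W] (f : V →ₗ⁅ℂ,L⁆ W)
    (hf : Function.Bijective f) : formalCharacter H V = formalCharacter H W := by
  ext ν
  rw [coeff_formalCharacter, coeff_formalCharacter, weightMult_congr f hf]

theorem bijective_of_irreducible [LieModule.IsIrreducible ℂ L V] [LieModule.IsIrreducible ℂ L W]
    (f : V →ₗ⁅ℂ,L⁆ W) {v : V} (hv : f v ≠ 0) : Function.Bijective f := by
  constructor
  · rw [← LieModuleHom.ker_eq_bot]
    refine (eq_bot_or_eq_top _).resolve_right fun h => hv ?_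
    have : v ∈ f.ker := by rw [h]; trivial
    exact this
  · rw [← LieModuleHom.range_eq_top]
    refine (eq_bot_or_eq_top _).resolve_left fun h => hv ?_
    have : f v ∈ f.range := ⟨v, rfl⟩
    rwa [h, LieSubmodule.mem_bot] at this

instance prodLieRingModule : LieRingModule L (V × W) where
  bracket x u := (⁅x, u.1⁆, ⁅x, u.2⁆)
  add_lie x y u := Prod.ext (add_lie x y u.1) (add_lie x y u.2)
  lie_add x u u' := Prod.ext (lie_add x u.1 u'.1) (lie_add x u.2 u'.2)
  leibniz_lie x y u := Prod.ext (leibniz_lie x y u.1) (leibniz_lie x y u.2)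

theorem prod_lie_def (x : L) (u : V × W) : ⁅x, u⁆ = (⁅x, u.1⁆, ⁅x, u.2⁆) := rfl

instance prodLieModule : LieModule ℂ L (V × W) where
  smul_lie c x u := Prod.ext (smul_lie c x u.1) (smul_lie c x u.2)
  lie_smul c x u := Prod.ext (lie_smul c x u.1) (lie_smul c x u.2)

/-- The submodule S of V × W generated by (v, w) is the graph of the isomorphism. Were the
projection to V not injective, its kernel would map onto W and S would contain (0, w); but the
λ-weight vectors of S are the multiples of (v, w). -/
theorem exists_equivariant_bijective {lam : Dual ℂ H} (hV : IsIrreducibleOfHighestWeight V b lam)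
    (hW : IsIrreducibleOfHighestWeight W b lam) :
    ∃ f : V →ₗ⁅ℂ,L⁆ W, Function.Bijective f := by
  obtain ⟨-, hVirr, v, hv0, hv⟩ := hV
  obtain ⟨-, hWirr, w, hw0, hw⟩ := hW
  have hvw : IsHighestWeightVector b lam (v, w) :=
    ⟨fun h => Prod.ext (hv.1 h) (hw.1 h), fun i hi x hx =>
      Prod.ext (hv.2 i hi x hx) (hw.2 i hi x hx)⟩
  let S := lowSubmodule hvw
  have hmem : (v, w) ∈ S := mem_lowSpan_self (b := b) (v, w)
  let p : S →ₗ⁅ℂ,L⁆ V :=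
    { (LinearMap.fst ℂ V W).comp S.toSubmodule.subtype with
      map_lie' := fun {x u} => rfl }
  let q : S →ₗ⁅ℂ,L⁆ W :=
    { (LinearMap.snd ℂ V W).comp S.toSubmodule.subtype with
      map_lie' := fun {x u} => rfl }
  have hpinj : Function.Injective p := by
    rw [← LieModuleHom.ker_eq_bot, LieSubmodule.eq_bot_iff]
    intro s hs
    have hs0 : p s = 0 := hs
    let K : LieSubmodule ℂ L W := p.ker.map q
    have hK : K = ⊥ := by
      refine (eq_bot_or_eq_top K).resolve_right fun h => ?_
      have hwK : w ∈ K := by rw [h]; trivial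
      obtain ⟨t, ht, htw⟩ := (LieSubmodule.mem_map _).mp hwK
      have ht0 : p t = 0 := ht
      have htS : (0, w) ∈ S := by
        have : (t : V × W) = (0, w) := Prod.ext ht0 htw
        rw [← this]
        exact t.2
      have h1 : ((0 : V), w) ∈ Submodule.span ℂ {(v, w)} := by
        refine mem_span_of_mem_lowSpan hvw htS (mem_weightSpace_iff.mpr fun h => ?_)
        exact Prod.ext (by simp [prod_lie_def]) (hw.1 h)
      obtain ⟨c, hc⟩ := Submodule.mem_span_singleton.mp h1
      have hc1 : c • v = 0 := congrArg Prod.fst hc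
      have hc2 : c • w = w := congrArg Prod.snd hc
      rw [(smul_eq_zero.mp hc1).resolve_right hv0, zero_smul] at hc2
      exact hw0 hc2.symm
    have hqs : q s ∈ K := LieSubmodule.mem_map_of_mem hs
    rw [hK, LieSubmodule.mem_bot] at hqs
    exact Subtype.ext (Prod.ext hs0 hqs)
  have hpsurj : Function.Surjective p := by
    rw [← LieModuleHom.range_eq_top]
    refine (eq_bot_or_eq_top _).resolve_left fun h => hv0 ?_
    have : p ⟨(v, w), hmem⟩ ∈ p.range := ⟨_, rfl⟩
    rwa [h, LieSubmodule.mem_bot] at this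
  let e : S ≃ₗ[ℂ] V := LinearEquiv.ofBijective (p : S →ₗ[ℂ] V) ⟨hpinj, hpsurj⟩
  have he : ∀ s, e.symm (p s) = s := e.symm_apply_apply
  let f : V →ₗ⁅ℂ,L⁆ W :=
    { (q : S →ₗ[ℂ] W).comp (e.symm : V →ₗ[ℂ] S) with
      map_lie' := fun {x u} => by
        obtain ⟨s, rfl⟩ := hpsurj u
        change q (e.symm ⁅x, p s⁆) = ⁅x, q (e.symm (p s))⁆
        rw [← LieModuleHom.map_lie, he, he, LieModuleHom.map_lie] }
  refine ⟨f, bijective_of_irreducible f (v := v) ?_⟩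
  have hfv : f v = w := by
    change q (e.symm (p ⟨(v, w), hmem⟩)) = w
    rw [he]
    rfl
  rwa [hfv]

end Equivariant

theorem IsIrreducibleCharacter.unique {μ : Dual ℂ H} {χ χ' : AddMonoidAlgebra ℤ (Dual ℂ H)}
    (h : IsIrreducibleCharacter b μ χ) (h' : IsIrreducibleCharacter b μ χ') : χ = χ' := by
  obtain ⟨V, _, _, _, _, _, hV, rfl⟩ := h
  obtain ⟨W, _, _, _, _, _, hW, rfl⟩ := h'
  obtain ⟨f, hf⟩ := exists_equivariant_bijective hV hW
  exact formalCharacter_congr f hf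

section WeightModule

/-- Subspaces of independent subspaces that already span everything cannot be proper. Used for
images of weight spaces, and for weight spaces inside generalised ones. -/
theorem le_of_iSupIndep_of_iSup_eq_top {ι V : Type*} [AddCommGroup V] [Module ℂ V]
    {A B : ι → Submodule ℂ V} (hB : iSupIndep B) (hAB : ∀ i, A i ≤ B i) (hA : ⨆ i, A i = ⊤)
    (i : ι) : B i ≤ A i := by
  intro x hx
  have h : x ∈ A i ⊔ ⨆ (j) (_ : j ≠ i), A j := by
    rw [← iSup_split_single A i, hA]
    trivial
  obtain ⟨y, hy, z, hz, rfl⟩ := Submodule.mem_sup.mp h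
  have hz' : z ∈ B i := by
    have := sub_mem hx (hAB i hy)
    rwa [add_sub_cancel_left] at this
  have hz0 : z = 0 := Submodule.disjoint_def.mp (hB i) z hz'
    (iSup₂_mono (fun j _ => hAB j) hz)
  rwa [hz0, add_zero]

variable (H) in
/-- `V` is spanned by its weight vectors. -/
def IsWeightModule (V : Type*) [AddCommGroup V] [Module ℂ V] [LieRingModule L V]
    [LieModule ℂ L V] : Prop :=
  ⨆ ν : Dual ℂ H, (LieModule.weightSpace V (ν : H → ℂ)).toSubmodule = ⊤

variable {V W : Type*} [AddCommGroup V] [Module ℂ V] [LieRingModule L V] [LieModule ℂ L V]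
  [AddCommGroup W] [Module ℂ W] [LieRingModule L W] [LieModule ℂ L W]

theorem IsIrreducibleOfHighestWeight.isWeightModule {lam : Dual ℂ H}
    (hV : IsIrreducibleOfHighestWeight V b lam) : IsWeightModule H V := by
  obtain ⟨-, hirr, v, h0, hv⟩ := hV
  rw [IsWeightModule, eq_top_iff, ← lowSpan_eq_top h0 hv]
  refine (lowSpan_le_weights hv).trans (sup_le ?_ (iSup_le fun ν => ?_))
  · rw [Submodule.span_singleton_le_iff_mem]
    exact Submodule.mem_iSup_of_mem lam (mem_weightSpace_iff.mpr hv.1)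
  · exact le_iSup (fun ν : Dual ℂ H => (LieModule.weightSpace V (ν : H → ℂ)).toSubmodule) ν.1

theorem map_iSup_weightSpace (hV : IsWeightModule H V) {f : V →ₗ⁅ℂ,L⁆ W}
    (hf : Function.Surjective f) :
    ⨆ ν : Dual ℂ H, (LieModule.weightSpace V (ν : H → ℂ)).toSubmodule.map (f : V →ₗ[ℂ] W) = ⊤ := by
  rw [← Submodule.map_iSup, hV, Submodule.map_top, LinearMap.range_eq_top]
  exact hf

theorem map_weightSpace_le (f : V →ₗ⁅ℂ,L⁆ W) (ν : Dual ℂ H) :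
    (LieModule.weightSpace V (ν : H → ℂ)).toSubmodule.map (f : V →ₗ[ℂ] W) ≤
      (LieModule.weightSpace W (ν : H → ℂ)).toSubmodule := by
  rintro _ ⟨v, hv, rfl⟩
  exact map_mem_weightSpace (f := f) hv

theorem IsWeightModule.of_surjective (hV : IsWeightModule H V) {f : V →ₗ⁅ℂ,L⁆ W}
    (hf : Function.Surjective f) : IsWeightModule H W := by
  rw [IsWeightModule, eq_top_iff, ← map_iSup_weightSpace hV hf]
  exact iSup_mono (map_weightSpace_le f)

theorem IsWeightModule.map_weightSpace (hV : IsWeightModule H V) {f : V →ₗ⁅ℂ,L⁆ W}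
    (hf : Function.Surjective f) (ν : Dual ℂ H) :
    (LieModule.weightSpace V (ν : H → ℂ)).toSubmodule.map (f : V →ₗ[ℂ] W) =
      (LieModule.weightSpace W (ν : H → ℂ)).toSubmodule :=
  le_antisymm (map_weightSpace_le f ν) (le_of_iSupIndep_of_iSup_eq_top (iSupIndep_weightSpace W)
    (map_weightSpace_le f) (map_iSup_weightSpace hV hf) ν)

theorem IsWeightModule.genWeightSpace_le (hV : IsWeightModule H V) (χ : H → ℂ) :
    LieModule.genWeightSpace V χ ≤ LieModule.weightSpace V χ := by
  refine le_of_iSupIndep_of_iSup_eq_top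
    (A := fun χ : H → ℂ => (LieModule.weightSpace V χ).toSubmodule)
    (LieSubmodule.iSupIndep_toSubmodule.mpr (LieModule.iSupIndep_genWeightSpace ℂ H V))
    (fun χ => LieModule.weightSpace_le_genWeightSpace V χ) ?_ χ
  rw [eq_top_iff, ← hV]
  exact iSup_le fun ν => le_iSup (fun χ : H → ℂ => (LieModule.weightSpace V χ).toSubmodule) ν

variable [FiniteDimensional ℂ V]

/-- Any finite-dimensional module is the sum of its generalised weight spaces; those of N lie in
those of V, where they consist of genuine weight vectors. -/
theorem IsWeightModule.submodule (hV : IsWeightModule H V) (N : LieSubmodule ℂ L V) :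
    IsWeightModule H N := by
  have h := LieModule.iSup_genWeightSpace_eq_top' ℂ H N
  rw [IsWeightModule, eq_top_iff, ← LieSubmodule.top_toSubmodule (R := ℂ) (L := H), ← h,
    LieSubmodule.iSup_toSubmodule]
  refine iSup_le fun χ => le_iSup_of_le χ.toLinear fun n hn => ?_
  have h1 : (n : V) ∈ LieModule.genWeightSpace V (χ : H → ℂ) := by
    let f : N →ₗ⁅ℂ,H⁆ V := { N.toSubmodule.subtype with map_lie' := fun {x u} => rfl }
    exact LieModule.map_genWeightSpace_le f (LieSubmodule.mem_map_of_mem hn)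
  have h2 := (LieModule.mem_weightSpace _ _).mp (hV.genWeightSpace_le _ h1)
  exact (LieModule.mem_weightSpace _ _).mpr fun x => Subtype.ext (h2 x)

/-- Rank–nullity on one weight space; that it maps onto the weight space of the quotient depends on
V being spanned by weight vectors. -/
theorem weightMult_add_quotient (hV : IsWeightModule H V) (N : LieSubmodule ℂ L V)
    (ν : Dual ℂ H) : weightMult V ν = weightMult N ν + weightMult (V ⧸ N) ν := by
  let P := (LieModule.weightSpace V (ν : H → ℂ)).toSubmodule
  let f := ((LieSubmodule.Quotient.mk' N : V →ₗ⁅ℂ,L⁆ V ⧸ N) : V →ₗ[ℂ] V ⧸ N).domRestrict P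
  have h1 := f.finrank_range_add_finrank_ker
  have h2 : f.range = (LieModule.weightSpace (V ⧸ N) (ν : H → ℂ)).toSubmodule := by
    rw [← hV.map_weightSpace (LieSubmodule.Quotient.surjective_mk' N) ν, LinearMap.range_domRestrict]
  let j : N →ₗ[ℂ] V := (N.incl : N →ₗ⁅ℂ,L⁆ V)
  let Q : Submodule ℂ N := (LieModule.weightSpace N (ν : H → ℂ)).toSubmodule
  have hj : Function.Injective j := Subtype.val_injective
  have h3 : f.ker.map P.subtype = Q.map j := by
    ext v
    constructor
    · rintro ⟨u, hu, rfl⟩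
      have hu' : (u : V) ∈ N := (LieSubmodule.Quotient.mk_eq_zero (N := N)).mp hu
      exact ⟨⟨u, hu'⟩, (LieModule.mem_weightSpace _ _).mpr fun x => Subtype.ext
        ((LieModule.mem_weightSpace _ _).mp u.2 x), rfl⟩
    · rintro ⟨u, hu, rfl⟩
      have hu' : (u : V) ∈ LieModule.weightSpace V (ν : H → ℂ) :=
        (LieModule.mem_weightSpace _ _).mpr fun x =>
          congrArg Subtype.val ((LieModule.mem_weightSpace _ _).mp hu x)
      exact ⟨⟨u, hu'⟩, (LieSubmodule.Quotient.mk_eq_zero (N := N)).mpr u.2, rfl⟩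
  have h4 : finrank ℂ f.ker = weightMult N ν := by
    rw [← Submodule.finrank_map_subtype_eq P f.ker, h3]
    exact (Submodule.equivMapOfInjective j hj Q).finrank_eq.symm
  have h5 : finrank ℂ f.range = weightMult (V ⧸ N) ν := by rw [h2]; rfl
  rw [h4, h5] at h1
  change finrank ℂ P = _
  omega

end WeightModule

end

/-! ### Weight bases, dominance of highest weights, and the ring of virtual characters -/

section

variable {b : (rootSystem H).Base}

section WeightBasis

variable {V : Type*} [AddCommGroup V] [Module ℂ V] [LieRingModule L V] [LieModule ℂ L V]

/-- The basis `v` consists of weight vectors, of weights `w`. -/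
def IsWeightBasis {ι : Type*} (v : Basis ι ℂ V) (w : ι → Dual ℂ H) : Prop :=
  ∀ i (h : H), ⁅(h : L), v i⁆ = w i h • v i

variable {ι : Type*} {v : Basis ι ℂ V} {w : ι → Dual ℂ H}

theorem IsWeightBasis.mem_weightSpace (hv : IsWeightBasis v w) (i : ι) :
    v i ∈ LieModule.weightSpace V (w i : H → ℂ) :=
  mem_weightSpace_iff.mpr (hv i)

theorem IsWeightBasis.isWeightModule (hv : IsWeightBasis v w) : IsWeightModule H V := by
  rw [IsWeightModule, eq_top_iff, ← v.span_eq, Submodule.span_le]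
  rintro _ ⟨i, rfl⟩
  exact Submodule.mem_iSup_of_mem (w i) (hv.mem_weightSpace i)

theorem IsWeightBasis.repr_eq_zero [Finite ι] (hv : IsWeightBasis v w) {ν : Dual ℂ H} {x : V}
    (hx : x ∈ LieModule.weightSpace V (ν : H → ℂ)) {i : ι} (hi : w i ≠ ν) : v.repr x i = 0 := by
  have := Fintype.ofFinite ι
  classical
  by_contra h0
  refine hi (LinearMap.ext fun h => ?_)
  have h1 := mem_weightSpace_iff.mp hx h
  have h2 : ⁅(h : L), x⁆ = ∑ j, (v.repr x j * w j h) • v j := by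
    conv_lhs => rw [← v.sum_repr x]
    rw [lie_sum]
    exact Finset.sum_congr rfl fun j _ => by rw [lie_smul, hv, smul_smul]
  have h3 : v.repr ⁅(h : L), x⁆ i = v.repr x i * w i h := by
    rw [h2, v.repr_sum_self]
  rw [h1, map_smul, Finsupp.smul_apply, smul_eq_mul, mul_comm] at h3
  exact (mul_left_cancel₀ h0 h3).symm

theorem IsWeightBasis.weightMult_eq [Finite ι] (hv : IsWeightBasis v w) (ν : Dual ℂ H) :
    weightMult V ν = Nat.card {i // w i = ν} := by
  classical
  have := Fintype.ofFinite ι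
  have h : (LieModule.weightSpace V (ν : H → ℂ)).toSubmodule =
      Submodule.span ℂ (Set.range fun i : {i // w i = ν} => v i) := by
    refine le_antisymm (fun x hx => ?_) ?_
    · rw [← v.sum_repr x]
      refine Submodule.sum_mem _ fun i _ => ?_
      by_cases hi : w i = ν
      · exact Submodule.smul_mem _ _ (Submodule.subset_span ⟨⟨i, hi⟩, rfl⟩)
      · rw [hv.repr_eq_zero hx hi, zero_smul]
        exact zero_mem _
    · rw [Submodule.span_le]
      rintro _ ⟨⟨i, rfl⟩, rfl⟩
      exact hv.mem_weightSpace i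
  rw [Nat.card_eq_fintype_card,
    ← finrank_span_eq_card (v.linearIndependent.comp _ Subtype.val_injective)]
  exact congrArg (fun N : Submodule ℂ V => finrank ℂ N) h

theorem IsWeightBasis.formalCharacter_eq [Fintype ι] [FiniteDimensional ℂ V]
    (hv : IsWeightBasis v w) :
    formalCharacter H V = ∑ i, AddMonoidAlgebra.single (w i) (1 : ℤ) := by
  classical
  ext ν
  rw [coeff_formalCharacter, hv.weightMult_eq, AddMonoidAlgebra.coeff_sum,
    Finsupp.finsetSum_apply, Nat.card_eq_fintype_card, Fintype.card_subtype]
  simp [AddMonoidAlgebra.coeff_single, Finsupp.single_apply]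

/-- The index type `Fin n` lets modules be rebuilt in `Type`, where `IsIrreducibleCharacter`
requires them, from a V in any universe. -/
theorem IsWeightModule.exists_basis [FiniteDimensional ℂ V] (hV : IsWeightModule H V) :
    ∃ (n : ℕ) (v : Basis (Fin n) ℂ V) (w : Fin n → Dual ℂ H), IsWeightBasis v w := by
  let s : Set V := {v | ∃ ν : Dual ℂ H, ∀ h : H, ⁅(h : L), v⁆ = ν h • v}
  have hs : ⊤ ≤ Submodule.span ℂ s := by
    rw [← hV]
    exact iSup_le fun ν v hv => Submodule.subset_span ⟨ν, mem_weightSpace_iff.mp hv⟩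
  let v := Basis.ofSpan hs
  obtain ⟨n, ⟨e⟩⟩ := Finite.exists_equiv_fin _ (h := Module.Finite.finite_basis v)
  have h : ∀ i, v.reindex e i ∈ s := fun i => by
    rw [Basis.reindex_apply]
    exact Basis.ofSpan_subset hs ⟨_, rfl⟩
  choose w hw using h
  exact ⟨n, v.reindex e, w, hw⟩

end WeightBasis

section HighestWeight

variable {V : Type*} [AddCommGroup V] [Module ℂ V] [LieRingModule L V] [LieModule ℂ L V]
  [FiniteDimensional ℂ V]

/-- A positive root vector raises the height, so it kills any vector whose weight has maximal
height. -/
theorem exists_highestWeightVector [Nontrivial V] (hV : IsWeightModule H V)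
    (b : (rootSystem H).Base) :
    ∃ (lam : Dual ℂ H) (v : V), v ≠ 0 ∧ IsHighestWeightVector b lam v := by
  have hfin := finite_support_weightMult (H := H) V
  have hne : (Function.support fun ν : Dual ℂ H => (weightMult V ν : ℤ)).Nonempty := by
    by_contra h
    rw [Set.not_nonempty_iff_eq_empty, Function.support_eq_empty_iff] at h
    refine bot_ne_top (α := Submodule ℂ V) ?_
    rw [← hV, eq_comm, iSup_eq_bot]
    intro ν
    have h1 : (weightMult V ν : ℤ) = 0 := congrFun h ν
    exact Submodule.finrank_eq_zero.mp (Nat.cast_eq_zero.mp h1)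
  obtain ⟨lam, hlam, hmax⟩ := Set.exists_max_image _ (fun ν => (heightFun b ν).re) hfin hne
  obtain ⟨v, hv0, hv⟩ := weightMult_ne_zero_iff.mp (Nat.cast_ne_zero.mp hlam)
  refine ⟨lam, v, hv0, hv, fun i hi x hx => ?_⟩
  by_contra h0
  have h1 : weightMult V ((rootSystem H).root i + lam) ≠ 0 :=
    weightMult_ne_zero_iff.mpr ⟨_, h0, mem_weightSpace_iff.mp
      (lie_mem_weightSpace_of_mem hx (mem_weightSpace_iff.mpr hv) rfl)⟩
  have h2 := hmax _ (Nat.cast_ne_zero.mpr h1)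
  have h3 := heightFun_pos b (root_mem_posCone b hi) ((rootSystem H).ne_zero i)
  rw [map_add, Complex.add_re] at h2
  linarith

/-- v is primitive for the sl₂-triple of each simple root, and in finite dimension the h-eigenvalue
of a primitive vector is a natural number. -/
theorem IsHighestWeightVector.mem_dominantWeights {lam : Dual ℂ H} {v : V}
    (hv : IsHighestWeightVector b lam v) (h0 : v ≠ 0) : lam ∈ dominantWeights b := by
  intro i hi
  have hnz : (i : LieModule.Weight ℂ H L).IsNonZero := H.isNonZero_coe_root i
  obtain ⟨h, e, f, t, he, hf⟩ := exists_isSl2Triple_of_weight_isNonZero hnz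
  have hh := t.h_eq_coroot hnz he hf
  have P : t.HasPrimitiveVectorWith v (lam ((rootSystem H).coroot i)) :=
    { ne_zero := h0
      lie_h := by rw [hh]; exact hv.1 _
      lie_e := hv.2 i (RootPairing.Base.isPos_of_mem_support hi) e he }
  exact P.exists_nat

theorem exists_isIrreducibleOfHighestWeight [LieModule.IsIrreducible ℂ L V]
    (hV : IsWeightModule H V) (b : (rootSystem H).Base) :
    ∃ lam ∈ dominantWeights b, IsIrreducibleOfHighestWeight V b lam := by
  have : Nontrivial V := LieModule.nontrivial_of_isIrreducible ℂ L V
  obtain ⟨lam, v, hv0, hv⟩ := exists_highestWeightVector hV b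
  exact ⟨lam, hv.mem_dominantWeights hv0, inferInstance, inferInstance, v, hv0, hv⟩

end HighestWeight

section VirtualCharacters

/-- The additive group generated by the characters of the irreducible representations with
dominant highest weight. -/
def virtualCharacters (b : (rootSystem H).Base) : AddSubgroup (AddMonoidAlgebra ℤ (Dual ℂ H)) :=
  AddSubgroup.closure {χ | ∃ μ ∈ dominantWeights b, IsIrreducibleCharacter b μ χ}

/-- Characters are additive along N ⊂ V → V/N, so induction on dimension reduces to irreducible
modules without splitting the extension. -/
theorem formalCharacter_mem_virtualCharacters (b : (rootSystem H).Base) (n : ℕ) :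
    ∀ (V : Type) [AddCommGroup V] [Module ℂ V] [LieRingModule L V] [LieModule ℂ L V]
      [FiniteDimensional ℂ V], IsWeightModule H V → finrank ℂ V = n →
      formalCharacter H V ∈ virtualCharacters b := by
  induction n using Nat.strong_induction_on with
  | _ n ih =>
    intro V _ _ _ _ _ hV hn
    by_cases hirr : LieModule.IsIrreducible ℂ L V
    · obtain ⟨lam, hlam, h⟩ := exists_isIrreducibleOfHighestWeight hV b
      exact AddSubgroup.subset_closure ⟨lam, hlam, V, _, _, _, _, _, h, rfl⟩
    by_cases htriv : Subsingleton V
    · have : formalCharacter H V = 0 := by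
        ext ν
        rw [coeff_formalCharacter]
        exact Nat.cast_eq_zero.mpr finrank_zero_of_subsingleton
      rw [this]
      exact zero_mem _
    rw [not_subsingleton_iff_nontrivial] at htriv
    obtain ⟨N, hN0, hN1⟩ : ∃ N : LieSubmodule ℂ L V, N ≠ ⊥ ∧ N ≠ ⊤ := by
      by_contra! h
      exact hirr (LieModule.IsIrreducible.mk h)
    have hsum : formalCharacter H V = formalCharacter H N + formalCharacter H (V ⧸ N) := by
      ext ν
      rw [AddMonoidAlgebra.coeff_add, Finsupp.add_apply, coeff_formalCharacter,
        coeff_formalCharacter, coeff_formalCharacter, weightMult_add_quotient hV N, Nat.cast_add]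
    have hd : finrank ℂ (V ⧸ N) + finrank ℂ N = finrank ℂ V :=
      N.toSubmodule.finrank_quotient_add_finrank
    have hd0 : finrank ℂ N ≠ 0 := fun h =>
      hN0 ((LieSubmodule.toSubmodule_eq_bot N).mp (Submodule.finrank_eq_zero.mp h))
    have hd1 : finrank ℂ N < finrank ℂ V :=
      Submodule.finrank_lt (s := N.toSubmodule) fun h =>
        hN1 ((LieSubmodule.toSubmodule_eq_top N).mp h)
    rw [hsum]
    exact add_mem (ih _ (by omega) N (hV.submodule N) rfl)
      (ih _ (by omega) (V ⧸ N) (hV.of_surjective (LieSubmodule.Quotient.surjective_mk' N)) rfl)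

theorem IsWeightBasis.sum_single_mem {ι V : Type} [Fintype ι] [AddCommGroup V] [Module ℂ V]
    [LieRingModule L V] [LieModule ℂ L V] {v : Basis ι ℂ V} {w : ι → Dual ℂ H}
    (hv : IsWeightBasis v w) (b : (rootSystem H).Base) :
    ∑ i, AddMonoidAlgebra.single (w i) (1 : ℤ) ∈ virtualCharacters b := by
  have : FiniteDimensional ℂ V := v.finiteDimensional_of_finite
  rw [← hv.formalCharacter_eq]
  exact formalCharacter_mem_virtualCharacters b _ V hv.isWeightModule rfl

/-- On generators the product is the character of the tensor product, whose weights add. -/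
theorem mul_mem_virtualCharacters {x y : AddMonoidAlgebra ℤ (Dual ℂ H)}
    (hx : x ∈ virtualCharacters b) (hy : y ∈ virtualCharacters b) :
    x * y ∈ virtualCharacters b := by
  induction hx using AddSubgroup.closure_induction with
  | zero => rw [zero_mul]; exact zero_mem _
  | add _ _ _ _ h h' => rw [add_mul]; exact add_mem h h'
  | neg _ _ h => rw [neg_mul]; exact neg_mem h
  | mem x hx =>
    induction hy using AddSubgroup.closure_induction with
    | zero => rw [mul_zero]; exact zero_mem _
    | add _ _ _ _ h h' => rw [mul_add]; exact add_mem h h'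
    | neg _ _ h => rw [mul_neg]; exact neg_mem h
    | mem y hy =>
      obtain ⟨_, _, V, _, _, _, _, _, hV, rfl⟩ := hx
      obtain ⟨_, _, W, _, _, _, _, _, hW, rfl⟩ := hy
      obtain ⟨n, v, p, hv⟩ := hV.isWeightModule.exists_basis
      obtain ⟨m, w, q, hw⟩ := hW.isWeightModule.exists_basis
      have hvw : IsWeightBasis (v.tensorProduct w) fun i => p i.1 + q i.2 := by
        rintro ⟨i, j⟩ h
        rw [Basis.tensorProduct_apply, TensorProduct.LieModule.lie_tmul_right, hv, hw,
          ← TensorProduct.smul_tmul', TensorProduct.tmul_smul, ← add_smul]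
        rfl
      rw [hv.formalCharacter_eq, hw.formalCharacter_eq, Finset.sum_mul_sum,
        ← Fintype.sum_prod_type']
      convert hvw.sum_single_mem b using 2 with i
      rw [AddMonoidAlgebra.single_mul_single, one_mul]

end VirtualCharacters

end

/-! ### Symmetric powers, Newton's identity and the Adams operation -/

section

variable {b : (rootSystem H).Base}

section SymmetricPower

open MvPolynomial

variable {V ι : Type*} [AddCommGroup V] [Module ℂ V] [LieRingModule L V] [LieModule ℂ L V]
  (v : Basis ι ℂ V)

/-- The embedding of `V` into its symmetric algebra. -/
def symLinear : V →ₗ[ℂ] MvPolynomial ι ℂ := v.constr ℂ X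

/-- The derivation of the symmetric algebra of `V` extending the action of `x`. -/
def symDerivation (x : L) : Derivation ℂ (MvPolynomial ι ℂ) (MvPolynomial ι ℂ) :=
  mkDerivation ℂ fun i => symLinear v ⁅x, v i⁆

theorem symLinear_basis (i : ι) : symLinear v (v i) = X i := v.constr_basis ℂ _ i

theorem symDerivation_X (x : L) (i : ι) : symDerivation v x (X i) = symLinear v ⁅x, v i⁆ :=
  mkDerivation_X _ _ _

theorem symDerivation_symLinear (x : L) (u : V) :
    symDerivation v x (symLinear v u) = symLinear v ⁅x, u⁆ := by
  have h : (symDerivation v x : MvPolynomial ι ℂ →ₗ[ℂ] MvPolynomial ι ℂ) ∘ₗ symLinear v =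
      symLinear v ∘ₗ LieModule.toEnd ℂ L V x :=
    v.ext fun i => by
      change symDerivation v x (symLinear v (v i)) = symLinear v ⁅x, v i⁆
      rw [symLinear_basis, symDerivation_X]
  exact LinearMap.congr_fun h u

theorem symDerivation_add (x y : L) :
    symDerivation v (x + y) = symDerivation v x + symDerivation v y :=
  derivation_ext fun i => by
    rw [Derivation.add_apply, symDerivation_X, symDerivation_X, symDerivation_X, add_lie, map_add]

theorem symDerivation_smul (c : ℂ) (x : L) : symDerivation v (c • x) = c • symDerivation v x :=
  derivation_ext fun i => by
    rw [Derivation.smul_apply, symDerivation_X, symDerivation_X, smul_lie, map_smul]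

theorem symDerivation_lie (x y : L) :
    symDerivation v ⁅x, y⁆ = ⁅symDerivation v x, symDerivation v y⁆ :=
  derivation_ext fun i => by
    rw [Derivation.commutator_apply, symDerivation_X, symDerivation_X, symDerivation_X,
      symDerivation_symLinear, symDerivation_symLinear, lie_lie, map_sub]

/-- The `n`-th symmetric power of `V`, in terms of the variables given by a basis of `V`. -/
def symPower {ι V : Type*} [AddCommGroup V] [Module ℂ V] (_v : Basis ι ℂ V) (n : ℕ) : Submodule ℂ (MvPolynomial ι ℂ) :=
  Submodule.span ℂ (Set.range fun s : {s : ι →₀ ℕ // s.degree = n} => monomial s.1 (1 : ℂ))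

variable {v}

theorem monomial_mem_symPower {n : ℕ} {s : ι →₀ ℕ} (hs : s.degree = n) (c : ℂ) :
    monomial s c ∈ symPower v n := by
  have h : monomial s c = c • monomial s (1 : ℂ) := by rw [smul_monomial, smul_eq_mul, mul_one]
  rw [h]
  exact Submodule.smul_mem _ _ (Submodule.subset_span ⟨⟨s, hs⟩, rfl⟩)

theorem monomial_mul_symLinear_mem {n : ℕ} {s : ι →₀ ℕ} (hs : s.degree + 1 = n) (c : ℂ) (u : V) :
    monomial s c * symLinear v u ∈ symPower v n := by
  rw [symLinear, v.constr_apply, Finsupp.sum, Finset.mul_sum]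
  refine Submodule.sum_mem _ fun i _ => ?_
  rw [mul_smul_comm]
  refine Submodule.smul_mem _ _ ?_
  rw [X, monomial_mul]
  refine monomial_mem_symPower ?_ _
  rw [map_add, Finsupp.degree_single, hs]

theorem symDerivation_mem {n : ℕ} (x : L) {p : MvPolynomial ι ℂ} (hp : p ∈ symPower v n) :
    symDerivation v x p ∈ symPower v n := by
  induction hp using Submodule.span_induction with
  | zero => rw [map_zero]; exact zero_mem _
  | add p q _ _ hp hq => rw [map_add]; exact add_mem hp hq
  | smul c p _ hp => rw [Derivation.map_smul]; exact Submodule.smul_mem _ _ hp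
  | mem p hp =>
    obtain ⟨⟨s, hs⟩, rfl⟩ := hp
    change symDerivation v x (monomial s 1) ∈ _
    rw [symDerivation, mkDerivation_monomial, one_smul]
    refine Submodule.sum_mem _ fun i hi => ?_
    refine monomial_mul_symLinear_mem ?_ _ _
    have h : (s - Finsupp.single i 1) + Finsupp.single i 1 = s :=
      tsub_add_cancel_of_le (Finsupp.single_le_iff.mpr
        (Nat.one_le_iff_ne_zero.mpr (Finsupp.mem_support_iff.mp hi)))
    rw [← hs]
    conv_rhs => rw [← h]
    rw [map_add, Finsupp.degree_single]

instance symPowerLieRingModule (n : ℕ) : LieRingModule L (symPower v n) where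
  bracket x p := ⟨symDerivation v x p, symDerivation_mem x p.2⟩
  add_lie x y p := Subtype.ext (by
    change symDerivation v (x + y) p.1 = symDerivation v x p.1 + symDerivation v y p.1
    rw [symDerivation_add, Derivation.add_apply])
  lie_add x p q := Subtype.ext (map_add (symDerivation v x) p.1 q.1)
  leibniz_lie x y p := Subtype.ext (by
    change symDerivation v x (symDerivation v y p.1) = symDerivation v ⁅x, y⁆ p.1 +
      symDerivation v y (symDerivation v x p.1)
    rw [symDerivation_lie, Derivation.commutator_apply, sub_add_cancel])

theorem coe_lie_symPower {n : ℕ} (x : L) (p : symPower v n) :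
    ((⁅x, p⁆ : symPower v n) : MvPolynomial ι ℂ) = symDerivation v x p := rfl

instance symPowerLieModule (n : ℕ) : LieModule ℂ L (symPower v n) where
  smul_lie c x p := Subtype.ext (by
    change symDerivation v (c • x) p.1 = c • symDerivation v x p.1
    rw [symDerivation_smul, Derivation.smul_apply])
  lie_smul c x p := Subtype.ext (Derivation.map_smul (symDerivation v x) c p.1)

variable (v) in
/-- The basis of monomials of a symmetric power. -/
def symPowerBasis (n : ℕ) : Basis {s : ι →₀ ℕ // s.degree = n} ℂ (symPower v n) :=
  Basis.span (v := fun s : {s : ι →₀ ℕ // s.degree = n} => monomial s.1 (1 : ℂ))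
    (((basisMonomials ι ℂ).linearIndependent.comp (fun s : {s : ι →₀ ℕ // s.degree = n} => s.1)
      Subtype.val_injective))

theorem coe_symPowerBasis {n : ℕ} (s : {s : ι →₀ ℕ // s.degree = n}) :
    (symPowerBasis v n s : MvPolynomial ι ℂ) = monomial s.1 1 :=
  congrArg Subtype.val (Basis.span_apply _ s)

theorem IsWeightBasis.symPower {w : ι → Dual ℂ H} (hv : IsWeightBasis v w) (n : ℕ) :
    IsWeightBasis (symPowerBasis v n) fun s => Finsupp.linearCombination ℕ w s.1 := by
  intro s h
  refine Subtype.ext ?_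
  rw [coe_lie_symPower, Submodule.coe_smul, coe_symPowerBasis, symDerivation,
    mkDerivation_monomial, one_smul]
  change _ = (Finsupp.linearCombination ℕ w s.1) h • monomial s.1 (1 : ℂ)
  rw [Finsupp.linearCombination_apply, Finsupp.sum, Finsupp.sum, LinearMap.sum_apply,
    Finset.sum_smul]
  refine Finset.sum_congr rfl fun i hi => ?_
  have hs : (s.1 - Finsupp.single i 1) + Finsupp.single i 1 = s.1 :=
    tsub_add_cancel_of_le (Finsupp.single_le_iff.mpr
      (Nat.one_le_iff_ne_zero.mpr (Finsupp.mem_support_iff.mp hi)))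
  rw [hv, map_smul, symLinear_basis, smul_eq_mul, mul_smul_comm, X, monomial_mul, hs, mul_one,
    LinearMap.smul_apply, smul_monomial, smul_monomial, nsmul_eq_mul, smul_eq_mul, smul_eq_mul,
    mul_one, mul_comm]

end SymmetricPower

section Newton

variable {ι M : Type*} [Fintype ι] [AddCommMonoid M] (w : ι → M)

instance (n : ℕ) : Finite {s : ι →₀ ℕ // s.degree = n} := by
  classical
  refine Finite.of_injective (β := Finset.finsuppAntidiag (Finset.univ : Finset ι) n)
    (fun s => ⟨s.1, ?_⟩) fun s t h =>
      Subtype.ext (congrArg (fun u => u.1) h)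
  rw [Finset.mem_finsuppAntidiag]
  exact ⟨by rw [← Finsupp.degree_eq_sum, s.2], Finset.subset_univ _⟩

instance (n : ℕ) : Fintype {s : ι →₀ ℕ // s.degree = n} := Fintype.ofFinite _

/-- The power sum `∑ᵢ e_{k wᵢ}`. -/
def powerSum (k : ℕ) : AddMonoidAlgebra ℤ M := ∑ i, AddMonoidAlgebra.single (k • w i) 1

/-- The complete symmetric function of the `e_{wᵢ}`. -/
def completeSum (n : ℕ) : AddMonoidAlgebra ℤ M :=
  ∑ s : {s : ι →₀ ℕ // s.degree = n},
    AddMonoidAlgebra.single (Finsupp.linearCombination ℕ w s.1) 1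

theorem completeSum_zero : completeSum w 0 = 1 := by
  have : Unique {s : ι →₀ ℕ // s.degree = 0} :=
    ⟨⟨0, map_zero _⟩, fun s => Subtype.ext ((Finsupp.degree_eq_zero_iff _).mp s.2)⟩
  rw [completeSum, Fintype.sum_unique]
  have h : (default : {s : ι →₀ ℕ // s.degree = 0}).1 = 0 :=
    (Finsupp.degree_eq_zero_iff _).mp (default : {s : ι →₀ ℕ // s.degree = 0}).2
  rw [h, map_zero]
  rfl

/-- Multiplication by e_{k w_i} adds k to the i-th exponent, a bijection onto the multi-indices of
degree n whose i-th entry is at least k. -/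
theorem single_mul_completeSum {n k : ℕ} (hk : k ≤ n) (i : ι) :
    AddMonoidAlgebra.single (k • w i) 1 * completeSum w (n - k) =
      ∑ s : {s : ι →₀ ℕ // s.degree = n}, if k ≤ s.1 i then
        AddMonoidAlgebra.single (Finsupp.linearCombination ℕ w s.1) (1 : ℤ) else 0 := by
  rw [completeSum, Finset.mul_sum, ← Finset.sum_filter]
  have hsub : ∀ s : {s : ι →₀ ℕ // s.degree = n},
      s ∈ Finset.univ.filter (fun s : {s : ι →₀ ℕ // s.degree = n} => k ≤ s.1 i) →
      s.1 - Finsupp.single i k + Finsupp.single i k = s.1 := fun s hs =>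
    tsub_add_cancel_of_le (Finsupp.single_le_iff.mpr (Finset.mem_filter.mp hs).2)
  refine Finset.sum_bij' (fun s _ => ⟨s.1 + Finsupp.single i k, ?_⟩)
    (fun s hs => ⟨s.1 - Finsupp.single i k, ?_⟩) ?_ ?_ ?_ ?_ ?_
  · rw [map_add, s.2, Finsupp.degree_single, Nat.sub_add_cancel hk]
  · have h := congrArg Finsupp.degree (hsub s hs)
    rw [map_add, s.2, Finsupp.degree_single] at h
    omega
  · intro s _
    simp
  · intro s _
    exact Finset.mem_univ _
  · intro s _
    exact Subtype.ext (add_tsub_cancel_right _ _)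
  · intro s hs
    exact Subtype.ext (hsub s hs)
  · intro s _
    rw [AddMonoidAlgebra.single_mul_single, one_mul, map_add, Finsupp.linearCombination_single,
      add_comm]

/-- Newton's identity by double counting: a multi-index s of degree n occurs on the right once for
each pair (i, k) with 1 ≤ k ≤ s_i, that is ∑ s_i = n times. -/
theorem natCast_mul_completeSum (n : ℕ) :
    (n : AddMonoidAlgebra ℤ M) * completeSum w n =
      ∑ k ∈ Finset.Icc 1 n, powerSum w k * completeSum w (n - k) := by
  have h : ∀ k ∈ Finset.Icc 1 n, powerSum w k * completeSum w (n - k) =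
      ∑ s : {s : ι →₀ ℕ // s.degree = n}, ∑ i, if k ≤ s.1 i then
        AddMonoidAlgebra.single (Finsupp.linearCombination ℕ w s.1) (1 : ℤ) else 0 := by
    intro k hk
    rw [powerSum, Finset.sum_mul, Finset.sum_comm]
    exact Finset.sum_congr rfl fun i _ => single_mul_completeSum w (Finset.mem_Icc.mp hk).2 i
  rw [Finset.sum_congr rfl h, Finset.sum_comm, completeSum, Finset.mul_sum]
  refine Finset.sum_congr rfl fun s _ => ?_
  rw [Finset.sum_comm]
  have h1 : ∀ i, (∑ k ∈ Finset.Icc 1 n, if k ≤ s.1 i then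
      AddMonoidAlgebra.single (Finsupp.linearCombination ℕ w s.1) (1 : ℤ) else 0) =
      (s.1 i : AddMonoidAlgebra ℤ M) *
        AddMonoidAlgebra.single (Finsupp.linearCombination ℕ w s.1) 1 := by
    intro i
    have h2 : (Finset.Icc 1 n).filter (fun k => k ≤ s.1 i) = Finset.Icc 1 (s.1 i) := by
      have h3 : s.1 i ≤ n := by
        exact (Finsupp.le_degree i s.1).trans_eq s.2
      ext k
      simp only [Finset.mem_filter, Finset.mem_Icc]
      omega
    rw [← Finset.sum_filter, h2, Finset.sum_const, Nat.card_Icc, Nat.add_sub_cancel, nsmul_eq_mul]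
  rw [Finset.sum_congr rfl fun i _ => h1 i, ← Finset.sum_mul, ← Nat.cast_sum,
    ← Finsupp.degree_eq_sum, s.2]

end Newton

section Adams

/-- The symmetric power is built from polynomials in variables indexed by ι, hence lies in `Type`
even if V does not. -/
theorem IsWeightBasis.completeSum_mem {ι : Type} {V : Type*} [Fintype ι] [AddCommGroup V] [Module ℂ V]
    [LieRingModule L V] [LieModule ℂ L V] {v : Basis ι ℂ V} {w : ι → Dual ℂ H}
    (hv : IsWeightBasis v w) (b : (rootSystem H).Base) (n : ℕ) :
    completeSum w n ∈ virtualCharacters b :=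
  (hv.symPower n).sum_single_mem b

/-- The term k = n of Newton's identity is p_n h_0 = p_n, so p_n is an integral expression in the
h_j and the earlier p_k; nothing has to be divided by n. -/
theorem IsWeightBasis.powerSum_mem {ι : Type} {V : Type*} [Fintype ι] [AddCommGroup V] [Module ℂ V]
    [LieRingModule L V] [LieModule ℂ L V] {v : Basis ι ℂ V} {w : ι → Dual ℂ H}
    (hv : IsWeightBasis v w) (b : (rootSystem H).Base) {n : ℕ} (hn : 0 < n) :
    powerSum w n ∈ virtualCharacters b := by
  induction n using Nat.strong_induction_on with
  | _ n ih =>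
    obtain ⟨m, rfl⟩ := Nat.exists_eq_succ_of_ne_zero hn.ne'
    have h := natCast_mul_completeSum w (m + 1)
    rw [Finset.sum_Icc_succ_top (Nat.succ_pos m), Nat.sub_self, completeSum_zero, mul_one] at h
    rw [Nat.succ_eq_add_one, ← sub_eq_iff_eq_add'.mpr h, ← nsmul_eq_mul]
    refine sub_mem (AddSubgroup.nsmul_mem _ (hv.completeSum_mem b _) _)
      (sum_mem fun k hk => mul_mem_virtualCharacters (ih k ?_ ?_) (hv.completeSum_mem b _))
    · exact Nat.lt_succ_of_le (Finset.mem_Icc.mp hk).2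
    · exact (Finset.mem_Icc.mp hk).1

theorem adams_sum_single {ι : Type*} [Fintype ι] (w : ι → Dual ℂ H) (a : ℕ) :
    adams a (∑ i, AddMonoidAlgebra.single (w i) (1 : ℤ)) = powerSum w a := by
  rw [map_sum]
  exact Finset.sum_congr rfl fun i _ => AddMonoidAlgebra.mapDomain_single

theorem adams_formalCharacter_mem {V : Type*} [AddCommGroup V] [Module ℂ V] [LieRingModule L V]
    [LieModule ℂ L V] [FiniteDimensional ℂ V] (hV : IsWeightModule H V)
    (b : (rootSystem H).Base) {a : ℕ} (ha : 0 < a) :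
    adams a (formalCharacter H V) ∈ virtualCharacters b := by
  obtain ⟨n, v, w, hv⟩ := hV.exists_basis
  rw [hv.formalCharacter_eq, adams_sum_single]
  exact hv.powerSum_mem b ha

end Adams

end

/-! ### Extraction of the multiplicities and the summation set -/

section

variable {b : (rootSystem H).Base}

section Multiplicities

theorem exists_isMultiplicityFunction {f : AddMonoidAlgebra ℤ (Dual ℂ H)}
    (hf : f ∈ virtualCharacters b) : ∃ m, IsMultiplicityFunction b f m := by
  classical
  -- One character is fixed for every weight, with 0 where none exists, so that multiplicity
  -- functions can be added; uniqueness of irreducible characters makes the choice harmless.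
  let χ : Dual ℂ H → AddMonoidAlgebra ℤ (Dual ℂ H) := fun μ =>
    if h : ∃ χ, IsIrreducibleCharacter b μ χ then h.choose else 0
  have hχ : ∀ {μ x}, IsIrreducibleCharacter b μ x → IsIrreducibleCharacter b μ (χ μ) := by
    intro μ x hx
    have h : ∃ χ, IsIrreducibleCharacter b μ χ := ⟨x, hx⟩
    change IsIrreducibleCharacter b μ (dite _ _ _)
    rw [dif_pos h]
    exact h.choose_spec
  suffices h : ∃ m : Dual ℂ H →₀ ℤ, (∀ μ ∈ m.support, μ ∈ dominantWeights b ∧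
      IsIrreducibleCharacter b μ (χ μ)) ∧ f = m.sum fun μ n => n • χ μ from
    h.imp fun m hm => ⟨χ, hm⟩
  induction hf using AddSubgroup.closure_induction with
  | mem x hx =>
    obtain ⟨μ, hμ, hx⟩ := hx
    refine ⟨Finsupp.single μ 1, fun ν hν => ?_, ?_⟩
    · rw [Finset.mem_singleton.mp (Finsupp.support_single_subset hν)]
      exact ⟨hμ, hχ hx⟩
    · rw [Finsupp.sum_single_index (by exact zero_smul ℤ (χ μ)), one_smul]
      exact hx.unique (hχ hx)
  | zero => exact ⟨0, fun μ hμ => absurd hμ (Finset.notMem_empty μ), Finsupp.sum_zero_index.symm⟩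
  | add x y _ _ hx hy =>
    obtain ⟨m, hm, rfl⟩ := hx
    obtain ⟨m', hm', rfl⟩ := hy
    refine ⟨m + m', fun μ hμ => ?_, ?_⟩
    · exact (Finset.mem_union.mp (Finsupp.support_add hμ)).elim (hm μ) (hm' μ)
    · exact (Finsupp.sum_add_index' (fun μ => zero_smul ℤ (χ μ))
        fun μ c d => add_smul c d (χ μ)).symm
  | neg x _ hx =>
    obtain ⟨m, hm, rfl⟩ := hx
    refine ⟨-m, fun μ hμ => hm μ (by rwa [Finsupp.support_neg] at hμ), ?_⟩
    rw [Finsupp.sum_neg_index fun μ => zero_smul ℤ (χ μ), Finsupp.sum, Finsupp.sum,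
      ← Finset.sum_neg_distrib]
    exact Finset.sum_congr rfl fun μ _ => (neg_smul _ _).symm

/-- Orthogonality of the irreducible characters against D, extended linearly. It determines m from
f, and so yields both uniqueness and the formula. -/
theorem IsMultiplicityFunction.coeff_weylDenominator_mul {f : AddMonoidAlgebra ℤ (Dual ℂ H)}
    {m : Dual ℂ H →₀ ℤ} (hm : IsMultiplicityFunction b f m) {μ : Dual ℂ H}
    (hμ : μ ∈ dominantWeights b) :
    (weylDenominator b * toComplex H f).coeff (μ + rho b) = m μ := by
  classical
  obtain ⟨χ, hχ, rfl⟩ := hm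
  rw [map_sum, Finset.mul_sum, AddMonoidAlgebra.coeff_sum, Finsupp.finsetSum_apply]
  have h : ∀ ν ∈ m.support, (weylDenominator b * toComplex H (m ν • χ ν)).coeff (μ + rho b) =
      if μ = ν then (m ν : ℂ) else 0 := by
    intro ν hν
    obtain ⟨hdom, V, _, _, _, _, _, hV, hVχ⟩ := hχ ν hν
    rw [map_zsmul, mul_smul_comm, AddMonoidAlgebra.coeff_smul, Finsupp.smul_apply, hVχ,
      coeff_weylDenominator_mul_character hV hdom hμ, zsmul_eq_mul, mul_ite, mul_one, mul_zero]
  rw [Finset.sum_congr rfl h, Finset.sum_ite_eq]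
  split_ifs with h0
  · rfl
  · rw [Finsupp.notMem_support_iff.mp h0, Int.cast_zero]

theorem IsMultiplicityFunction.mem_dominantWeights {f : AddMonoidAlgebra ℤ (Dual ℂ H)}
    {m : Dual ℂ H →₀ ℤ} (hm : IsMultiplicityFunction b f m) {μ : Dual ℂ H} (hμ : m μ ≠ 0) :
    μ ∈ dominantWeights b := by
  obtain ⟨χ, hχ, -⟩ := hm
  exact (hχ μ (Finsupp.mem_support_iff.mpr hμ)).1

theorem IsMultiplicityFunction.unique {f : AddMonoidAlgebra ℤ (Dual ℂ H)} {m m' : Dual ℂ H →₀ ℤ}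
    (hm : IsMultiplicityFunction b f m) (hm' : IsMultiplicityFunction b f m') : m = m' := by
  ext μ
  by_cases hμ : μ ∈ dominantWeights b
  · have h := (hm.coeff_weylDenominator_mul hμ).symm.trans (hm'.coeff_weylDenominator_mul hμ)
    exact_mod_cast h
  · rw [not_imp_comm.mp hm.mem_dominantWeights hμ, not_imp_comm.mp hm'.mem_dominantWeights hμ]

theorem eq_nsmul_iff {M : Type*} [AddCommGroup M] [Module ℂ M] {a : ℕ} (ha : 0 < a) {x y : M} :
    x = a • y ↔ (a : ℂ)⁻¹ • x = y := by
  have h : (a : ℂ) ≠ 0 := Nat.cast_ne_zero.mpr ha.ne'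
  rw [← Nat.cast_smul_eq_nsmul ℂ, inv_smul_eq_iff₀ h]

theorem coeff_adams {a : ℕ} (ha : 0 < a) (f : AddMonoidAlgebra ℤ (Dual ℂ H)) (ν : Dual ℂ H) :
    (adams a f).coeff ν = f.coeff ((a : ℂ)⁻¹ • ν) := by
  classical
  induction f using AddMonoidAlgebra.induction_linear with
  | zero => rw [map_zero]; rfl
  | add f g hf hg =>
    rw [map_add, AddMonoidAlgebra.coeff_add, AddMonoidAlgebra.coeff_add, Finsupp.add_apply,
      Finsupp.add_apply, hf, hg]
  | single μ r =>
    have h : adams a (AddMonoidAlgebra.single μ r) = AddMonoidAlgebra.single (a • μ) r :=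
      AddMonoidAlgebra.mapDomain_single
    rw [h, AddMonoidAlgebra.coeff_single, AddMonoidAlgebra.coeff_single, Finsupp.single_apply,
      Finsupp.single_apply]
    refine if_congr ?_ rfl rfl
    rw [eq_comm, eq_nsmul_iff ha, eq_comm]

theorem dominantWeights_subset_weightLattice : dominantWeights b ⊆ weightLattice H := by
  intro μ hμ i
  have hi := b.coroot_mem_span_int i
  generalize (rootSystem H).coroot i = y at hi ⊢
  induction hi using Submodule.span_induction with
  | mem x hx =>
    obtain ⟨j, hj, rfl⟩ := hx
    obtain ⟨n, hn⟩ := hμ j hj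
    exact ⟨n, by rw [hn, Int.cast_natCast]⟩
  | zero => exact ⟨0, by rw [map_zero, Int.cast_zero]⟩
  | add x y _ _ hx hy =>
    obtain ⟨n, hn⟩ := hx
    obtain ⟨k, hk⟩ := hy
    exact ⟨n + k, by rw [map_add, hn, hk, Int.cast_add]⟩
  | smul c x _ hx =>
    obtain ⟨n, hn⟩ := hx
    exact ⟨c * n, by rw [map_zsmul, hn, zsmul_eq_mul, Int.cast_mul]⟩

variable {V : Type*} [AddCommGroup V] [Module ℂ V] [LieRingModule L V] [LieModule ℂ L V]
  [FiniteDimensional ℂ V] {lam : Dual ℂ H} {a : ℕ}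

theorem IsIrreducibleOfHighestWeight.mem_weightLattice (hV : IsIrreducibleOfHighestWeight V b lam)
    (hlam : lam ∈ dominantWeights b) {ν : Dual ℂ H} (hν : weightMult V ν ≠ 0) :
    ν ∈ weightLattice H := by
  intro i
  obtain ⟨n, hn⟩ := exists_int_apply_coroot_of_mem_posCone (hV.sub_mem_posCone hν) i
  obtain ⟨k, hk⟩ := dominantWeights_subset_weightLattice hlam i
  refine ⟨k - n, ?_⟩
  rw [LinearMap.sub_apply, hk] at hn
  rw [Int.cast_sub, ← hn, sub_sub_cancel]

open Classical in
-- The term det(σ) e_{σρ} of D picks out the coefficient of ψ_a(ch) at μ + ρ - σρ, which is a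
-- multiplicity at that weight divided by a. Restricting to lattice weights drops only zeros, since
-- every weight of V is in Λ.
theorem coeff_weylDenominator_mul_adams (hV : IsIrreducibleOfHighestWeight V b lam)
    (hlam : lam ∈ dominantWeights b) (ha : 0 < a) (μ : Dual ℂ H) :
    (weylDenominator b * toComplex H (adams a (formalCharacter H V))).coeff (μ + rho b) =
      ∑ σ : Weyl H with shiftedWeight b a μ σ ∈ weightLattice H,
        weylSign σ * (weightMult V (shiftedWeight b a μ σ) : ℂ) := by
  rw [weylDenominator_eq_sum, Finset.sum_mul, AddMonoidAlgebra.coeff_sum, Finsupp.finsetSum_apply,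
    Finset.sum_filter]
  refine Finset.sum_congr rfl fun σ _ => ?_
  rw [coeff_single_mul_sub, coeff_toComplex, coeff_adams ha, coeff_formalCharacter,
    Int.cast_natCast]
  split_ifs with h
  · rfl
  · have h0 : weightMult V (shiftedWeight b a μ σ) = 0 :=
      not_imp_comm.mp (hV.mem_weightLattice hlam) h
    change weylSign σ * (weightMult V (shiftedWeight b a μ σ) : ℂ) = 0
    rw [h0, Nat.cast_zero, mul_zero]

theorem summationSet_eq (hV : IsIrreducibleOfHighestWeight V b lam)
    (hlam : lam ∈ dominantWeights b) (ha : 0 < a) :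
    summationSet b a V =
      (⋃ σ : Weyl H, {μ | ∃ ν ∈ weightSet H V, μ = (σ • rho b - rho b) + a • ν}) ∩
        dominantWeights b := by
  have hshift : ∀ (μ ν : Dual ℂ H) (σ : Weyl H),
      μ = (σ • rho b - rho b) + a • ν ↔ shiftedWeight b a μ σ = ν := by
    intro μ ν σ
    rw [shiftedWeight, ← eq_nsmul_iff ha, ← sub_eq_iff_eq_add', sub_sub_eq_add_sub]
  ext μ
  rw [Set.mem_inter_iff, and_comm, Set.mem_iUnion]
  refine and_congr_right fun _ => exists_congr fun σ => ?_
  constructor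
  · rintro ⟨-, h⟩
    exact ⟨_, weightMult_ne_zero_iff.mp h, (hshift _ _ _).mpr rfl⟩
  · rintro ⟨ν, hν, h⟩
    rw [(hshift _ _ _).mp h]
    have h0 := weightMult_ne_zero_iff.mpr hν
    exact ⟨hV.mem_weightLattice hlam h0, h0⟩

theorem finite_weightSet : (weightSet H V).Finite :=
  (finite_support_weightMult (H := H) V).subset fun _ hν =>
    Nat.cast_ne_zero.mpr (weightMult_ne_zero_iff.mpr hν)

theorem finite_summationSet (hV : IsIrreducibleOfHighestWeight V b lam)
    (hlam : lam ∈ dominantWeights b) (ha : 0 < a) : (summationSet b a V).Finite := by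
  rw [summationSet_eq hV hlam ha]
  refine (Set.finite_iUnion fun σ => ?_).inter_of_left _
  refine ((finite_weightSet (V := V)).image fun ν => (σ • rho b - rho b) + a • ν).subset ?_
  rintro μ ⟨ν, hν, rfl⟩
  exact ⟨ν, hν, rfl⟩

theorem IsMultiplicityFunction.mem_summationSet (hV : IsIrreducibleOfHighestWeight V b lam)
    (hlam : lam ∈ dominantWeights b) (ha : 0 < a) {m : Dual ℂ H →₀ ℤ}
    (hm : IsMultiplicityFunction b (adams a (formalCharacter H V)) m) {μ : Dual ℂ H}
    (hμ : m μ ≠ 0) : μ ∈ summationSet b a V := by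
  classical
  have hdom := hm.mem_dominantWeights hμ
  refine ⟨hdom, ?_⟩
  by_contra! h
  refine hμ (Int.cast_injective (α := ℂ) ?_)
  rw [← hm.coeff_weylDenominator_mul hdom, coeff_weylDenominator_mul_adams hV hlam ha,
    Int.cast_zero]
  refine Finset.sum_eq_zero fun σ hσ => ?_
  rw [h σ (Finset.mem_filter.mp hσ).2, Nat.cast_zero, mul_zero]

/-- On the support of m the value of χ is forced by uniqueness of irreducible characters; elsewhere
the factor m μ = 0 removes the term, whatever χ is there. -/
theorem IsMultiplicityFunction.eq_finsum {f : AddMonoidAlgebra ℤ (Dual ℂ H)} {m : Dual ℂ H →₀ ℤ}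
    (hm : IsMultiplicityFunction b f m) {S : Set (Dual ℂ H)} (hS : ∀ μ, m μ ≠ 0 → μ ∈ S)
    {χ : Dual ℂ H → AddMonoidAlgebra ℤ (Dual ℂ H)}
    (hχ : ∀ μ, m μ ≠ 0 → IsIrreducibleCharacter b μ (χ μ)) : f = ∑ᶠ μ ∈ S, m μ • χ μ := by
  obtain ⟨χ', hχ', rfl⟩ := hm
  rw [finsum_mem_eq_sum_of_subset (t := m.support)]
  · refine Finset.sum_congr rfl fun μ hμ => ?_
    rw [(hχ' μ hμ).2.unique (hχ μ (Finsupp.mem_support_iff.mp hμ))]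
  · rintro μ ⟨-, hμ⟩
    rw [Finset.mem_coe, Finsupp.mem_support_iff]
    intro h
    refine hμ ?_
    change m μ • χ μ = 0
    rw [h, zero_smul]
  · exact fun μ hμ => hS μ (Finsupp.mem_support_iff.mp hμ)

end Multiplicities

end

end Plethysm

end

open Classical Plethysm in
theorem mainTheorem8 {L : Type*} [LieRing L] [LieAlgebra ℂ L] [FiniteDimensional ℂ L]
    [LieAlgebra.IsSimple ℂ L] (H : LieSubalgebra ℂ L) [H.IsCartanSubalgebra]
    (b : (rootSystem H).Base) (a : ℕ) (ha : 0 < a)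
    (lam : Dual ℂ H) (hlam : lam ∈ dominantWeights b)
    (V : Type*) [AddCommGroup V] [Module ℂ V] [LieRingModule L V] [LieModule ℂ L V]
    [FiniteDimensional ℂ V] (hV : IsIrreducibleOfHighestWeight V b lam) :
    (∃! m : Dual ℂ H →₀ ℤ, IsMultiplicityFunction b (adams a (formalCharacter H V)) m) ∧
    ∀ m : Dual ℂ H →₀ ℤ, IsMultiplicityFunction b (adams a (formalCharacter H V)) m →
      (∀ μ ∈ dominantWeights b,
        (m μ : ℂ) = ∑ σ : Weyl H with shiftedWeight b a μ σ ∈ weightLattice H,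
          weylSign σ * (weightMult V (shiftedWeight b a μ σ) : ℂ)) ∧
      summationSet b a V =
        (⋃ σ : Weyl H, {μ | ∃ ν ∈ weightSet H V, μ = (σ • rho b - rho b) + a • ν}) ∩
          dominantWeights b ∧
      (summationSet b a V).Finite ∧
      (∀ μ, m μ ≠ 0 → μ ∈ summationSet b a V) ∧
      ∀ χ : Dual ℂ H → AddMonoidAlgebra ℤ (Dual ℂ H),
        (∀ μ, m μ ≠ 0 → IsIrreducibleCharacter b μ (χ μ)) →
        adams a (formalCharacter H V) = ∑ᶠ μ ∈ summationSet b a V, m μ • χ μ := by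
  refine ⟨?_, fun m hm => ⟨fun μ hμ => ?_, summationSet_eq hV hlam ha,
    finite_summationSet hV hlam ha, fun μ => hm.mem_summationSet hV hlam ha,
    fun χ hχ => hm.eq_finsum (fun μ => hm.mem_summationSet hV hlam ha) hχ⟩⟩
  · obtain ⟨m, hm⟩ :=
      exists_isMultiplicityFunction (adams_formalCharacter_mem hV.isWeightModule b ha)
    exact ⟨m, hm, fun m' hm' => hm'.unique hm⟩
  · rw [← hm.coeff_weylDenominator_mul hμ]
    exact coeff_weylDenominator_mul_adams hV hlam ha μ
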